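/- Let $K$ be a field. All algebras are associative and unital, and subalgebras contain the unit. A $K$-algebra $A$ is called locally finite-dimensional (LFD) if every finite subset of $A$ generates a finite-dimensional $K$-subalgebra, and central if its centre is $K$. Denote by $d(K)$ the class of finite-dimensional central division $K$-algebras. Let $\mathbb{P}$ be the set of prime numbers and, for each $p \in \mathbb{P}$, let $R\{p\}$ be a central division LFD-algebra over $K$ such that for every $r_p \in R\{p\}$ the degree $[K(r_p) : K]$ equals $p^{\nu(r_p)}$ for some integer $\nu(r_p) \ge 0$. Suppose that, for every $p \in \mathbb{P}$, no noncommutative $K$-subalgebra of $R\{p\}$ belongs to $d(K)$. Then the tensor product $R = \bigotimes_{p \in \mathbb{P}} R\{p\}$ over $K$ (the direct limit of the tensor products over $K$ of the algebras $R\{p\}$, $p \in \Pi$, where $\Pi$ runs over the finite subsets of $\mathbb{P}$ and the transition maps insert the unit in the missing factors) is a central division LFD-algebra over $K$, and no noncommutative $K$-subalgebra of $R$ belongs to $d(K)$. -/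

import Mathlib

open scoped TensorProduct

namespace LFDTensor

/-- `A` is a division ring: `A` is nonzero and all its nonzero elements are invertible. -/
def IsDivision (A : Type*) [Ring A] : Prop :=
  Nontrivial A ∧ ∀ a : A, a ≠ 0 → IsUnit a

/-- A (not necessarily finite-dimensional) central division algebra over the field `K`. -/
def IsCentralDivision (K : Type*) [Field K] (A : Type*) [Ring A] [Algebra K A] : Prop :=
  IsDivision A ∧ Algebra.IsCentral K A

/-- Membership in the class `d(K)` of finite-dimensional central division `K`-algebras. -/
def MemD (K : Type*) [Field K] (A : Type*) [Ring A] [Algebra K A] : Prop :=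
  IsCentralDivision K A ∧ FiniteDimensional K A

/-- Locally finite-dimensional algebras: every finite subset generates a finite-dimensional
`K`-subalgebra. -/
def IsLFD (K : Type*) [Field K] (A : Type*) [Ring A] [Algebra K A] : Prop :=
  ∀ s : Finset A, FiniteDimensional K (Algebra.adjoin K (s : Set A))

/-- The tensor product `⊗ i, A i` over the field `K` of a possibly infinite family of unital
`K`-algebras, in the usual sense of algebras: the direct limit of the tensor products over finite
sets of indices, along the maps which insert the unit in the missing factors.

Mathlib's `⨂[K] i, A i` has as pure tensors the `⊗ a i` for arbitrary families `a`, which for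
infinitely many factors is too big. Inside it, the finite tensor products embed (see
`finTensor_injective` below) by putting `1` in the remaining factors, and the usual tensor product is the
union of their images (see `mem_algTensor_iff` below), that is, the `K`-subalgebra generated by the canonical copies
`1 ⊗ ⋯ ⊗ A i ⊗ ⋯ ⊗ 1` of the factors. -/
noncomputable def algTensor (K : Type*) [Field K] {ι : Type*} [DecidableEq ι] (A : ι → Type*)
    [∀ i, Ring (A i)] [∀ i, Algebra K (A i)] : Subalgebra K (⨂[K] i, A i) :=
  ⨆ i, (PiTensorProduct.singleAlgHom (R := K) (A := A) i).range

/-- The canonical map `⊗ (i ∈ s), A i → ⨂[K] i, A i` for a finite set `s` of indices: put `1` in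
the remaining factors. -/
noncomputable def finTensor (K : Type*) [Field K] {ι : Type*} [DecidableEq ι] (A : ι → Type*)
    [∀ i, Ring (A i)] [∀ i, Algebra K (A i)] (s : Finset ι) :
    (⨂[K] i : s, A i) →ₐ[K] ⨂[K] i, A i :=
  PiTensorProduct.liftAlgHom
    { toFun := fun x => PiTensorProduct.tprod K
        (fun i => if h : i ∈ s then x ⟨i, h⟩ else (1 : A i))
      map_update_add' := by
        intro _ m i x y
        have key : ∀ z : A i, (fun j => if h : j ∈ s then Function.update m i z ⟨j, h⟩ else
            (1 : A j)) = Function.update (fun j => if h : j ∈ s then m ⟨j, h⟩ else (1 : A j))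
              (i : ι) z := by
          intro z
          funext j
          by_cases hj : j = i
          · subst hj; simp
          · have : ∀ h : j ∈ s, (⟨j, h⟩ : s) ≠ i := fun h e => hj (congrArg Subtype.val e)
            by_cases h : j ∈ s <;> simp [hj, h, this]
        simp only [key, MultilinearMap.map_update_add]
      map_update_smul' := by
        intro _ m i c x
        have key : ∀ z : A i, (fun j => if h : j ∈ s then Function.update m i z ⟨j, h⟩ else
            (1 : A j)) = Function.update (fun j => if h : j ∈ s then m ⟨j, h⟩ else (1 : A j))
              (i : ι) z := by
          intro z
          funext j
          by_cases hj : j = i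
          · subst hj; simp
          · have : ∀ h : j ∈ s, (⟨j, h⟩ : s) ≠ i := fun h e => hj (congrArg Subtype.val e)
            by_cases h : j ∈ s <;> simp [hj, h, this]
        simp only [key, MultilinearMap.map_update_smul] }
    (by
      change PiTensorProduct.tprod K _ = PiTensorProduct.tprod K _
      congr 1
      funext i
      by_cases h : i ∈ s <;> simp [h])
    (by
      intro x y
      change PiTensorProduct.tprod K _ = PiTensorProduct.tprod K _ * PiTensorProduct.tprod K _
      rw [PiTensorProduct.tprod_mul_tprod]
      congr 1
      funext i
      by_cases h : i ∈ s <;> simp [h])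

theorem finTensor_tprod (K : Type*) [Field K] {ι : Type*} [DecidableEq ι] (A : ι → Type*)
    [∀ i, Ring (A i)] [∀ i, Algebra K (A i)] (s : Finset ι) (x : ∀ i : s, A i) :
    finTensor K A s (PiTensorProduct.tprod K x) = PiTensorProduct.tprod K
        (fun i => if h : i ∈ s then x ⟨i, h⟩ else (1 : A i)) :=
  PiTensorProduct.lift.tprod x

open Classical in
/-- The finite tensor products embed in `⨂[K] i, A i`. -/
theorem finTensor_injective (K : Type*) [Field K] {ι : Type*} [dι : DecidableEq ι] (A : ι → Type*)
    [∀ i, Ring (A i)] [∀ i, Algebra K (A i)] [∀ i, Nontrivial (A i)] (s : Finset ι) :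
    Function.Injective (finTensor K A s) := by
  have hφ : ∀ i, ∃ φ : A i →ₗ[K] K, φ 1 = 1 := fun i =>
    Module.Projective.exists_dual_eq_one K (one_ne_zero (α := A i))
  choose φ hφ1 using hφ
  let c : (∀ i, A i) → K := fun m =>
    if {j | m j ≠ 1}.Finite then ∏ᶠ j, (if j ∈ s then 1 else φ j (m j)) else 0
  have hfin : ∀ (m : ∀ i, A i) i z, {j | Function.update m i z j ≠ 1}.Finite ↔
      {j | m j ≠ 1}.Finite := by
    intro m i z
    constructor
    · intro h
      refine (h.insert i).subset fun j hj => ?_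
      by_cases e : j = i
      · exact Or.inl e
      · exact Or.inr (by simpa [e] using hj)
    · intro h
      refine (h.insert i).subset fun j hj => ?_
      by_cases e : j = i
      · exact Or.inl e
      · exact Or.inr (by simpa [e] using hj)
  have hc1 : ∀ (m : ∀ i, A i) i z, i ∈ s → c (Function.update m i z) = c m := by
    intro m i z hi
    simp only [c, hfin]
    congr 1
    refine finprod_congr fun j => ?_
    by_cases e : j = i
    · subst e; simp [hi]
    · simp [e]
  have hc2 : ∀ (m : ∀ i, A i) i, i ∉ s → ∃ C : K, ∀ z, c (Function.update m i z) = φ i z * C := by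
    intro m i hi
    by_cases hm : {j | m j ≠ 1}.Finite
    · refine ⟨∏ᶠ j, (if j = i then 1 else if j ∈ s then 1 else φ j (m j)), fun z => ?_⟩
      have h1 : c (Function.update m i z) = ∏ᶠ j, (if j = i then φ i z else 1) *
          (if j = i then 1 else if j ∈ s then 1 else φ j (m j)) := by
        simp only [c, hfin, hm, if_true]
        refine finprod_congr fun j => ?_
        by_cases e : j = i
        · subst e; simp [hi]
        · simp [e]
      rw [h1, finprod_mul_distrib, finprod_eq_single _ i]
      · simp
      · intro j hj; simp [hj]
      · refine (Set.finite_singleton i).subset fun j hj => ?_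
        by_contra e
        exact hj (if_neg e)
      · refine hm.subset fun j hj e => hj ?_
        simp [e, hφ1]
    · exact ⟨0, fun z => by simp [c, hfin, hm]⟩
  let r : (∀ i, A i) → ⨂[K] i : s, A i := fun m =>
    PiTensorProduct.tprod K (fun i : s => m i)
  have hr1 : ∀ (m : ∀ i, A i) (i : s) z, r (Function.update m i z) =
      PiTensorProduct.tprod K (Function.update (fun i : s => m i) i z) := by
    intro m i z
    simp only [r]
    congr 1
    funext j
    by_cases e : j = i
    · subst e; simp
    · have : (j : ι) ≠ i := fun h => e (Subtype.ext h)
      simp [e, this]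
  have hr2 : ∀ (m : ∀ i, A i) i z, i ∉ s → r (Function.update m i z) = r m := by
    intro m i z hi
    simp only [r]
    congr 1
    funext j
    have : (j : ι) ≠ i := fun h => hi (h ▸ j.2)
    simp [this]
  let F : MultilinearMap K A (⨂[K] i : s, A i) :=
    { toFun := fun m => c m • r m
      map_update_add' := by
        intro inst m i x y
        obtain rfl := Subsingleton.elim inst dι
        by_cases hi : i ∈ s
        · have h := hr1 m ⟨i, hi⟩
          simp only at h
          simp only [hc1 _ _ _ hi, h, MultilinearMap.map_update_add, smul_add]
        · obtain ⟨C, hC⟩ := hc2 m i hi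
          simp only [hC, hr2 _ _ _ hi, map_add, add_mul, add_smul]
      map_update_smul' := by
        intro inst m i a x
        obtain rfl := Subsingleton.elim inst dι
        by_cases hi : i ∈ s
        · have h := hr1 m ⟨i, hi⟩
          simp only at h
          simp only [hc1 _ _ _ hi, h, MultilinearMap.map_update_smul]
          rw [smul_comm]
        · obtain ⟨C, hC⟩ := hc2 m i hi
          simp only [hC, hr2 _ _ _ hi, map_smul, smul_eq_mul, mul_assoc, mul_smul] }
  have hcomp : PiTensorProduct.lift F ∘ₗ (finTensor K A s).toLinearMap = LinearMap.id := by
    refine PiTensorProduct.ext (MultilinearMap.ext fun x => ?_)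
    change PiTensorProduct.lift F (finTensor K A s (PiTensorProduct.tprod K x)) =
      PiTensorProduct.tprod K x
    rw [finTensor_tprod, PiTensorProduct.lift.tprod]
    have e1 : c (fun i => if h : i ∈ s then x ⟨i, h⟩ else (1 : A i)) = 1 := by
      simp only [c]
      rw [if_pos]
      · refine finprod_eq_one_of_forall_eq_one fun j => ?_
        by_cases h : j ∈ s <;> simp [h, hφ1]
      · refine s.finite_toSet.subset fun j hj => ?_
        by_contra e
        exact hj (dif_neg e)
    have e2 : r (fun i => if h : i ∈ s then x ⟨i, h⟩ else (1 : A i)) =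
        PiTensorProduct.tprod K x := by simp [r]
    change c (fun i => if h : i ∈ s then x ⟨i, h⟩ else (1 : A i)) •
      r (fun i => if h : i ∈ s then x ⟨i, h⟩ else (1 : A i)) = _
    rw [e1, e2, one_smul]
  exact Function.LeftInverse.injective (g := PiTensorProduct.lift F)
    fun x => LinearMap.congr_fun hcomp x

/-- `algTensor K A` is the (directed) union of the images of the finite tensor products; with
`finTensor_injective` this identifies it with their direct limit. -/
theorem mem_algTensor_iff (K : Type*) [Field K] {ι : Type*} [DecidableEq ι] (A : ι → Type*)
    [∀ i, Ring (A i)] [∀ i, Algebra K (A i)] (x : ⨂[K] i, A i) :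
    x ∈ algTensor K A ↔ ∃ s : Finset ι, x ∈ (finTensor K A s).range := by
  have hsingle : ∀ (s : Finset ι) (m : ∀ i, A i), (∀ i ∉ s, m i = 1) →
      PiTensorProduct.tprod K m ∈ algTensor K A := by
    intro s
    induction s using Finset.induction_on with
    | empty =>
      intro m hm
      have : m = 1 := funext fun i => hm i (Finset.notMem_empty i)
      rw [this, ← PiTensorProduct.one_def]
      exact one_mem _
    | insert a s ha ih =>
      intro m hm
      have : m = Pi.mulSingle a (m a) * Function.update m a 1 := by
        funext i
        by_cases e : i = a
        · subst e; simp
        · simp [e]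
      rw [this, ← PiTensorProduct.tprod_mul_tprod]
      refine mul_mem ?_ (ih _ fun i hi => ?_)
      · exact le_iSup (fun i => (PiTensorProduct.singleAlgHom (R := K) (A := A) i).range) a
          (AlgHom.mem_range_self (PiTensorProduct.singleAlgHom (R := K) (A := A) a) (m a))
      · by_cases e : i = a
        · subst e; simp
        · simpa [e] using hm i (by simp [e, hi])
  have hmono : Monotone fun s : Finset ι => (finTensor K A s).range := by
    rintro s t hst _ ⟨z, rfl⟩
    change finTensor K A s z ∈ (finTensor K A t).range
    induction z using PiTensorProduct.induction_on with
    | smul_tprod r m =>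
      rw [map_smul]
      refine Subalgebra.smul_mem _ ((AlgHom.mem_range _).2 ⟨PiTensorProduct.tprod K
        fun i : t => if h : (i : ι) ∈ s then m ⟨i, h⟩ else (1 : A i), ?_⟩) r
      change finTensor K A t _ = _
      rw [finTensor_tprod, finTensor_tprod]
      congr 1
      funext i
      by_cases h : i ∈ s
      · simp [h, hst h]
      · simp [h]
    | add x y hx hy => rw [map_add]; exact add_mem hx hy
  constructor
  · intro hx
    have hle : algTensor K A ≤ ⨆ s : Finset ι, (finTensor K A s).range := by
      refine iSup_le fun i => le_trans ?_ (le_iSup _ {i})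
      rintro _ ⟨a, rfl⟩
      refine ⟨PiTensorProduct.tprod K fun j : ({i} : Finset ι) =>
        (Pi.mulSingle i a : ∀ i, A i) j, ?_⟩
      change finTensor K A {i} _ = PiTensorProduct.tprod K (Pi.mulSingle i a)
      rw [finTensor_tprod]
      congr 1
      funext j
      by_cases e : j = i
      · subst e; simp
      · simp [e]
    have hx' := hle hx
    rw [← SetLike.mem_coe, Subalgebra.coe_iSup_of_directed hmono.directed_le] at hx'
    exact Set.mem_iUnion.1 hx'
  · rintro ⟨s, z, rfl⟩
    change finTensor K A s z ∈ algTensor K A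
    induction z using PiTensorProduct.induction_on with
    | smul_tprod r m =>
      rw [map_smul, finTensor_tprod]
      exact Subalgebra.smul_mem _ (hsingle s _ fun i hi => by simp [hi]) r
    | add x y hx hy => rw [map_add]; exact add_mem hx hy

end LFDTensor

namespace LFDTensor

/-! A prime dividing the dimension of a finite-dimensional division algebra divides the degree of an
element of a maximal commutative subalgebra (`exists_dvd_finrank_adjoin`). Hence `p` is the only
possible prime divisor of the dimension of a finite-dimensional subalgebra of `R p`, and subalgebras
of different factors have coprime dimensions. Tensor products of division algebras of coprime
dimensions are division algebras (`isDivision_tensor`). The algebra `R` is a union of finite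
products of this kind, so it is a division LFD-algebra; its centre is found by comparing
coefficients.

Now let `S` be a noncommutative subalgebra of `R` in the class `d(K)`. It lies in a finite product
`G` of finite-dimensional subalgebras `B i` of the factors. A prime `p` dividing the dimension of
`S` divides that of `G`, hence that of exactly one factor `D = B p`. Left multiplication by `S` and
right multiplication by `D` make `G` a representation of `S ⊗ Dᵐᵒᵖ` of dimension `dim D * e` with
`e` prime to `p`. In Brauer group terms, the `p`-primary component `T` of `S` must then embed in
`D`, which the hypothesis on `R p` forbids (`exists_central_division_algHom`).

The Brauer group is replaced by divisibility of dimensions of representations. Let `S` have degree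
`n`, and let `t k` be the degree of the division algebra underlying the `k`-th tensor power of `S`.
Every representation of that power has dimension divisible by `n ^ k * t k`, and this dimension
occurs. Symmetric tensors give a representation of dimension `n ^ k * (n + k - 1).choose k`
(`hasRep_tensorPower`), and for a large power `k` of a prime `q` the binomial coefficient is prime
to `q`. Thus `q` does not divide `t k` when `k` is a multiple of a large power of `q`. For a
suitable `l`, `t (l + 1)` is a power of `p` and `t l` is prime to `p`; comparing dimensions shows
that the division algebra `T` underlying the power `l + 1` is nontrivial and that `T ⊗ Dᵐᵒᵖ` acts on
a space of dimension `dim D`, which embeds `T` in `D`. -/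

/-- `X` has a representation of dimension `d` over `K`. -/
def HasRep (K X : Type*) [Field K] [Ring X] [Algebra K X] (d : ℕ) : Prop :=
  Nonempty (X →ₐ[K] Matrix (Fin d) (Fin d) K)

/-! ### Dimensions of representations -/

section Rep

variable {K X Y : Type*} [Field K] [Ring X] [Algebra K X] [Ring Y] [Algebra K Y]

theorem hasRep_of_end {V : Type*} [AddCommGroup V] [Module K V] [FiniteDimensional K V]
    (ρ : X →ₐ[K] Module.End K V) : HasRep K X (Module.finrank K V) :=
  ⟨(algEquivMatrix (Module.finBasis K V)).toAlgHom.comp ρ⟩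

theorem HasRep.exists_end {d : ℕ} (h : HasRep K X d) :
    Nonempty (X →ₐ[K] Module.End K (Fin d → K)) :=
  h.map fun f => (Matrix.toLinAlgEquiv' (R := K) (n := Fin d)).toAlgHom.comp f

theorem HasRep.comp {d : ℕ} (h : HasRep K Y d) (f : X →ₐ[K] Y) : HasRep K X d :=
  h.map fun g => g.comp f

theorem HasRep.tensor {d e : ℕ} (h : HasRep K X d) (h' : HasRep K Y e) :
    HasRep K (X ⊗[K] Y) (d * e) := by
  obtain ⟨f⟩ := h.exists_end
  obtain ⟨g⟩ := h'.exists_end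
  have := hasRep_of_end ((Module.endTensorEndAlgHom (R := K) (A := K) (M := Fin d → K)
    (N := Fin e → K)).comp (Algebra.TensorProduct.map f g))
  simpa using this

theorem hasRep_self [FiniteDimensional K X] : HasRep K X (Module.finrank K X) :=
  hasRep_of_end (Algebra.lmul K X)

/-- The action makes `V` a vector space over `D`, and dimensions multiply in towers. -/
theorem finrank_dvd_of_end {D V : Type*} [DivisionRing D] [Algebra K D] 
    [AddCommGroup V] [Module K V] [FiniteDimensional K V]
    (ρ : D →ₐ[K] Module.End K V) : Module.finrank K D ∣ Module.finrank K V := by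
  let : Module D V := Module.compHom V ρ.toRingHom
  have hs : ∀ (d : D) (v : V), d • v = ρ d v := fun _ _ => rfl
  have : IsScalarTower K D V := ⟨fun a d v => by simp [hs]⟩
  exact ⟨_, (Module.finrank_mul_finrank K D V).symm⟩

theorem HasRep.finrank_dvd {D : Type*} [DivisionRing D] [Algebra K D] {d : ℕ}
    (h : HasRep K D d) : Module.finrank K D ∣ d := by
  obtain ⟨f⟩ := h.exists_end
  simpa using finrank_dvd_of_end f

theorem HasRep.matrix {e : ℕ} (h : HasRep K Y e) (r : ℕ) :
    HasRep K (Matrix (Fin r) (Fin r) Y) (r * e) := by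
  obtain ⟨f⟩ := h
  have := hasRep_of_end ((Matrix.toLinAlgEquiv' (R := K)).toAlgHom.comp
    ((Matrix.compAlgEquiv (Fin r) (Fin e) K K).toAlgHom.comp f.mapMatrix))
  simpa using this

/-- Morita equivalence: the matrix units split the space into `r` copies of the range `W` of the
idempotent `E 0 0`, and scalar matrices preserve `W`. -/
theorem HasRep.of_matrix {r d : ℕ} [NeZero r] (h : HasRep K (Matrix (Fin r) (Fin r) Y) d) :
    ∃ e, d = r * e ∧ HasRep K Y e := by
  obtain ⟨ρ⟩ := h.exists_end
  let E (i j : Fin r) : Module.End K (Fin d → K) := ρ (Matrix.single i j 1)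
  let W := LinearMap.range (E 0 0)
  have hE : ∀ i j k l, E i j * E k l = if j = k then E i l else 0 := by
    intro i j k l
    simp only [E, ← map_mul]
    by_cases hjk : j = k
    · subst hjk; simp
    · simp [hjk, Matrix.single_mul_single_of_ne]
  have hE' : ∀ i j k l v, E i j (E k l v) = if j = k then E i l v else 0 := by
    intro i j k l v
    rw [← Module.End.mul_apply, hE]
    split_ifs <;> rfl
  have hW : ∀ w : W, E 0 0 w = w := by
    rintro ⟨_, v, rfl⟩
    simp [hE']
  have hone : ∑ i, E i i = 1 := by
    rw [← map_sum, ← map_one ρ]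
    congr 1
    ext a b
    simp [Matrix.sum_apply, Matrix.single_apply, Matrix.one_apply, ite_and]
  let e : (Fin d → K) ≃ₗ[K] (Fin r → W) :=
    { toFun := fun v i => ⟨E 0 i v, E 0 i v, by simp [hE']⟩
      map_add' := fun v w => by ext; simp
      map_smul' := fun c v => by ext; simp
      invFun := fun w => ∑ i, E i 0 (w i)
      left_inv := fun v => by
        simp only [hE', if_true]
        rw [← LinearMap.sum_apply, hone]; rfl
      right_inv := fun w => by
        funext i
        apply Subtype.ext
        simp only [map_sum, hE', Finset.sum_ite_eq, Finset.mem_univ, if_true]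
        exact hW _ }
  have hd : d = r * Module.finrank K W := by
    have := e.finrank_eq
    rw [Module.finrank_fin_fun, Module.finrank_pi_fintype] at this
    simpa using this
  refine ⟨_, hd, ?_⟩
  let σ : Y →ₐ[K] Matrix (Fin r) (Fin r) Y := Matrix.scalarAlgHom (Fin r) K
  have hcomm : ∀ y v, ρ (σ y) (E 0 0 v) = E 0 0 (ρ (σ y) v) := by
    intro y v
    rw [← Module.End.mul_apply, ← Module.End.mul_apply, ← map_mul, ← map_mul]
    congr 2
    ext i j
    simp [σ, Matrix.single_apply]
  have hinv : ∀ y, ∀ w ∈ W, ρ (σ y) w ∈ W := by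
    rintro y _ ⟨v, rfl⟩
    exact ⟨_, (hcomm y v).symm⟩
  let τ : Y →ₐ[K] Module.End K W :=
    { toFun := fun y => (ρ (σ y)).restrict (hinv y)
      map_one' := by ext; simp
      map_mul' := fun a b => by ext; simp
      map_zero' := by ext; simp
      map_add' := fun a b => by ext; simp
      commutes' := fun c => by ext; simp [Module.algebraMap_end_apply] }
  exact hasRep_of_end τ

end Rep

/-! ### Simplicity of tensor products -/

section Simple

variable {K X Y : Type*} [Field K] [Ring X] [Algebra K X] [Ring Y] [Algebra K Y]

/-- The tensor product of a central simple algebra with a simple algebra is simple. -/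
theorem isSimpleRing_tensor [IsSimpleRing X] [Algebra.IsCentral K X] [IsSimpleRing Y] :
    IsSimpleRing (X ⊗[K] Y) := by
  classical
  have hne : ∀ I : TwoSidedIdeal (X ⊗[K] Y), I ≠ ⊥ → (1 : X ⊗[K] Y) ∈ I := by
    intro I hI
    let b := Module.Free.chooseBasis K Y
    let c : X ⊗[K] Y ≃ₗ[K] (Module.Free.ChooseBasisIndex K Y →₀ X) :=
      TensorProduct.equivFinsuppOfBasisRight b
    have hcl : ∀ x z k, c ((x ⊗ₜ 1) * z) k = x * c z k := by
      intro x z k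
      induction z using TensorProduct.induction_on with
      | zero => simp
      | tmul u v => simp [c]
      | add u v hu hv => simp [mul_add, hu, hv]
    have hcr : ∀ x z k, c (z * (x ⊗ₜ 1)) k = c z k * x := by
      intro x z k
      induction z using TensorProduct.induction_on with
      | zero => simp
      | tmul u v => simp [c]
      | add u v hu hv => simp [add_mul, hu, hv]
    obtain ⟨z₀, hz₀, hz₀0⟩ : ∃ z ∈ I, z ≠ 0 := by
      by_contra! h
      exact hI (eq_bot_iff.2 fun z hz => by simpa using h z hz)
    -- Take a nonzero element of `I` with the fewest nonzero coordinates, these being elements of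
    -- `X` with respect to a `K`-basis of `Y`.
    have hex : ∃ m, ∃ z ∈ I, z ≠ 0 ∧ (c z).support.card = m := ⟨_, z₀, hz₀, hz₀0, rfl⟩
    obtain ⟨z, hz, hz0, hzm⟩ := Nat.find_spec hex
    have hmin : ∀ w ∈ I, (c w).support ⊂ (c z).support → w = 0 := by
      intro w hw hlt
      by_contra hw0
      exact Nat.find_min hex (hzm ▸ Finset.card_lt_card hlt) ⟨w, hw, hw0, rfl⟩
    obtain ⟨k, hk⟩ : ∃ k, c z k ≠ 0 := by
      by_contra! h
      exact hz0 (c.injective (by ext k; simpa using h k))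
    -- The `k`-th coordinates of the elements of `I` supported within the support of `z` form a
    -- nonzero ideal of `X`, so one such element `w` has `k`-th coordinate `1`.
    let J : TwoSidedIdeal X := TwoSidedIdeal.mk' 
      {x | ∃ w ∈ I, (c w).support ⊆ (c z).support ∧ c w k = x}
      ⟨0, I.zero_mem, by simp, by simp⟩
      (by
        rintro _ _ ⟨w, hw, hs, rfl⟩ ⟨w', hw', hs', rfl⟩
        refine ⟨w + w', I.add_mem hw hw', ?_, by simp⟩
        rw [map_add]
        exact Finsupp.support_add.trans (Finset.union_subset hs hs'))
      (by
        rintro _ ⟨w, hw, hs, rfl⟩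
        exact ⟨-w, I.neg_mem hw, by simpa using hs, by simp⟩)
      (by
        rintro x _ ⟨w, hw, hs, rfl⟩
        refine ⟨(x ⊗ₜ 1) * w, I.mul_mem_left _ _ hw, fun j hj => hs ?_, hcl _ _ _⟩
        rw [Finsupp.mem_support_iff] at hj ⊢
        exact fun h => hj (by rw [hcl, h, mul_zero]))
      (by
        rintro _ x ⟨w, hw, hs, rfl⟩
        refine ⟨w * (x ⊗ₜ 1), I.mul_mem_right _ _ hw, fun j hj => hs ?_, hcr _ _ _⟩
        rw [Finsupp.mem_support_iff] at hj ⊢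
        exact fun h => hj (by rw [hcr, h, zero_mul]))
    have hJ : ∀ x, x ∈ J ↔ ∃ w ∈ I, (c w).support ⊆ (c z).support ∧ c w k = x :=
      fun x => TwoSidedIdeal.mem_mk' _ _ _ _ _ _ _
    obtain ⟨w, hw, hs, hw1⟩ := (hJ 1).1
      (IsSimpleRing.one_mem_of_ne_zero_mem J hk ((hJ _).2 ⟨z, hz, subset_rfl, rfl⟩))
    -- The commutator loses the coordinate `k`, so it vanishes by minimality. The coordinates of `w`
    -- are therefore central, and `w` has the form `1 ⊗ₜ y`.
    have hcomm : ∀ x : X, (x ⊗ₜ 1) * w - w * (x ⊗ₜ 1) = 0 := by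
      intro x
      refine hmin _ (I.sub_mem (I.mul_mem_left _ _ hw) (I.mul_mem_right _ _ hw)) ?_
      refine Finset.ssubset_iff_subset_ne.2 ⟨fun j hj => hs ?_, fun h => ?_⟩
      · rw [Finsupp.mem_support_iff] at hj ⊢
        exact fun h => hj (by simp [hcl, hcr, h])
      · have : k ∈ (c z).support := by simpa using hk
        rw [← h] at this
        simp [hcl, hcr, hw1] at this
    have hcen : ∀ j, ∃ a : K, c w j = algebraMap K X a := by
      intro j
      refine Algebra.IsCentral.mem_center_iff K |>.1 (Subalgebra.mem_center_iff.2 fun x => ?_)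
      have := DFunLike.congr_fun (congrArg c (hcomm x)) j
      rw [map_sub, Finsupp.sub_apply, hcl, hcr, map_zero, Finsupp.zero_apply, sub_eq_zero] at this
      exact this
    choose a ha using hcen
    have hwy : ∃ y : Y, w = 1 ⊗ₜ y := by
      refine ⟨(c w).support.sum fun j => a j • b j, ?_⟩
      have hsum : w = (c w).sum fun j x => x ⊗ₜ b j := by
        rw [← TensorProduct.equivFinsuppOfBasisRight_symm_apply]
        exact (c.symm_apply_apply w).symm
      conv_lhs => rw [hsum]
      rw [Finsupp.sum, TensorProduct.tmul_sum]
      refine Finset.sum_congr rfl fun j _ => ?_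
      rw [ha j, Algebra.algebraMap_eq_smul_one, TensorProduct.smul_tmul]
    obtain ⟨y, rfl⟩ := hwy
    have hy0 : y ≠ 0 := by
      rintro rfl
      simp at hw1
    let I' : TwoSidedIdeal Y := I.comap (Algebra.TensorProduct.includeRight : Y →ₐ[K] X ⊗[K] Y)
    have h1 : (1 : Y) ∈ I' := IsSimpleRing.one_mem_of_ne_zero_mem I' hy0
      (by rw [TwoSidedIdeal.mem_comap]; exact hw)
    rw [TwoSidedIdeal.mem_comap] at h1
    simpa [Algebra.TensorProduct.one_def] using h1
  have : Nontrivial (X ⊗[K] Y) := inferInstance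
  refine IsSimpleRing.of_eq_bot_or_eq_top fun I => ?_
  by_cases h : I = ⊥
  · exact Or.inl h
  · exact Or.inr ((TwoSidedIdeal.one_mem_iff I).1 (hne I h))

end Simple

/-! ### Descent of linear algebra along a field extension -/

section BaseChange

variable {K L M N : Type*} [Field K] [Field L] [Algebra K L] [AddCommGroup M] [Module K M]
  [AddCommGroup N] [Module K N] [Module L N] [IsScalarTower K L N] {f : M →ₗ[K] N}

/-- A functional over `K` that kills `W` but not `x` extends `L`-linearly and separates `f x` from
the span. -/
theorem mem_of_isBaseChange (h : IsBaseChange L f) (W : Submodule K M) {x : M}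
    (hx : f x ∈ Submodule.span L (f '' W)) : x ∈ W := by
  by_contra hxW
  obtain ⟨l, hl, hW⟩ := Submodule.exists_le_ker_of_notMem hxW
  let l' : N →ₗ[L] L := h.lift ((Algebra.linearMap K L).comp l)
  have hl' : ∀ y, l' (f y) = algebraMap K L (l y) := fun y => h.lift_eq _ y
  have hker : Submodule.span L (f '' W) ≤ LinearMap.ker l' := by
    rw [Submodule.span_le]
    rintro _ ⟨y, hy, rfl⟩
    have : l y = 0 := hW hy
    simp [hl', this]
  have := hker hx
  rw [LinearMap.mem_ker, hl', map_eq_zero] at this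
  exact hl this

theorem injective_of_isBaseChange (h : IsBaseChange L f) : Function.Injective f := by
  rw [injective_iff_map_eq_zero]
  intro x hx
  have := mem_of_isBaseChange h ⊥ (x := x) (by rw [hx]; exact zero_mem _)
  simpa using this

theorem span_range_of_isBaseChange (h : IsBaseChange L f) :
    Submodule.span L (Set.range f) = ⊤ := by
  rw [eq_top_iff]
  intro n _
  induction n using h.inductionOn with
  | zero => exact zero_mem _
  | tmul m => exact Submodule.subset_span ⟨m, rfl⟩
  | smul s n hn => exact Submodule.smul_mem _ _ (hn trivial)
  | add a b ha hb => exact add_mem (ha trivial) (hb trivial)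

/-- The common kernel of a family of linear maps defined over `K` is spanned by its `K`-rational
elements. -/
theorem span_iInf_ker {ι : Type*} (h : IsBaseChange L f) (g : ι → M →ₗ[K] M) (g' : ι → N →ₗ[L] N)
    (hg : ∀ i x, g' i (f x) = f (g i x)) :
    Submodule.span L (f '' (⨅ i, LinearMap.ker (g i) : Submodule K M)) =
      ⨅ i, LinearMap.ker (g' i) := by
  apply le_antisymm
  · rw [Submodule.span_le]
    rintro _ ⟨x, hx, rfl⟩
    simp only [SetLike.mem_coe, Submodule.mem_iInf, LinearMap.mem_ker] at hx ⊢
    intro i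
    rw [hg, hx, map_zero]
  · intro n hn
    simp only [Submodule.mem_iInf, LinearMap.mem_ker] at hn
    let b := Module.Free.chooseBasis K L
    let c := TensorProduct.equivFinsuppOfBasisLeft (N := M) b
    -- Expand `n` in a `K`-basis of `L`: since the `g' i` extend maps defined over `K`, the
    -- equations for `n` hold separately for each coordinate `z j`.
    let z := c (h.equiv.symm n)
    have hsum : ∀ u : Module.Free.ChooseBasisIndex K L →₀ M,
        h.equiv (c.symm u) = u.sum fun j m => b j • f m := by
      intro u
      simp only [c, TensorProduct.equivFinsuppOfBasisLeft_symm_apply, Finsupp.sum, map_sum,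
        h.equiv_tmul]
    have hz : n = z.sum fun j m => b j • f m := by
      rw [← hsum]; simp [z]
    have hzk : ∀ j, z j ∈ (⨅ i, LinearMap.ker (g i) : Submodule K M) := by
      intro j
      simp only [Submodule.mem_iInf, LinearMap.mem_ker]
      intro i
      have h0 : h.equiv (c.symm (z.mapRange (g i) (map_zero _))) = 0 := by
        rw [hsum, Finsupp.sum_mapRange_index (by simp), ← hn i]
        conv_rhs => rw [hz]
        simp [Finsupp.sum, hg]
      have h1 : z.mapRange (g i) (map_zero _) = 0 := by simpa using h0
      simpa using DFunLike.congr_fun h1 j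
    rw [hz]
    exact Submodule.sum_mem _ fun j _ => Submodule.smul_mem _ _
      (Submodule.subset_span ⟨_, hzk j, rfl⟩)

theorem finrank_span_of_isBaseChange (h : IsBaseChange L f) (W : Submodule K M) :
    Module.finrank L (Submodule.span L (f '' W)) = Module.finrank K W := by
  let ψ : L ⊗[K] W →ₗ[L] N := h.equiv.toLinearMap ∘ₗ W.subtype.baseChange L
  have hinj : Function.Injective ψ := by
    refine h.equiv.injective.comp ?_
    exact Module.Flat.lTensor_preserves_injective_linearMap (M := L) W.subtype
      W.injective_subtype
  have hr : LinearMap.range ψ = Submodule.span L (f '' W) := by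
    apply le_antisymm
    · rintro _ ⟨z, rfl⟩
      induction z using TensorProduct.induction_on with
      | zero => simp
      | tmul l w =>
        simp only [ψ, LinearMap.comp_apply, LinearMap.baseChange_tmul]
        change h.equiv _ ∈ _
        rw [h.equiv_tmul]
        exact Submodule.smul_mem _ _ (Submodule.subset_span ⟨_, w.2, rfl⟩)
      | add a b ha hb => rw [map_add]; exact add_mem ha hb
    · rw [Submodule.span_le]
      rintro _ ⟨w, hw, rfl⟩
      refine ⟨1 ⊗ₜ ⟨w, hw⟩, ?_⟩
      simp only [ψ, LinearMap.comp_apply, LinearMap.baseChange_tmul]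
      change h.equiv _ = _
      rw [h.equiv_tmul]
      simp
  rw [← hr, LinearMap.finrank_range_of_inj hinj, Module.finrank_baseChange]

theorem isBaseChange_of_span [FiniteDimensional K M] [FiniteDimensional L N]
    (hs : Submodule.span L (Set.range f) = ⊤) (hd : Module.finrank K M = Module.finrank L N) :
    IsBaseChange L f := by
  let ψ : L ⊗[K] M →ₗ[L] N := f.liftBaseChange L
  have hsurj : Function.Surjective ψ := by
    rw [← LinearMap.range_eq_top, eq_top_iff, ← hs, Submodule.span_le]
    rintro _ ⟨m, rfl⟩
    exact ⟨1 ⊗ₜ m, by simp [ψ]⟩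
  have hinj : Function.Injective ψ := by
    rw [LinearMap.injective_iff_surjective_of_finrank_eq_finrank]
    · exact hsurj
    · rw [Module.finrank_baseChange, hd]
  exact IsBaseChange.of_equiv (LinearEquiv.ofBijective ψ ⟨hinj, hsurj⟩) fun x => by
    change ψ (1 ⊗ₜ x) = f x
    simp [ψ]

end BaseChange

/-! ### Forms of matrix algebras -/

section Form

variable {K L X I : Type*} [Field K] [Field L] [Algebra K L] [Ring X] [Algebra K X]
  [Fintype I] [DecidableEq I] {φ : X →ₐ[K] Matrix I I L}

/-- The image of `φ` spans all matrices over `L`, so `m` is central. -/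
theorem exists_smul_one_of_commute {m : Matrix I I L}
    (h : IsBaseChange L φ.toLinearMap) (hm : ∀ x, φ x * m = m * φ x) : ∃ c : L, m = c • 1 := by
  have hall : ∀ a : Matrix I I L, a * m = m * a := by
    intro a
    have ha : a ∈ Submodule.span L (Set.range φ.toLinearMap) := by
      rw [span_range_of_isBaseChange h]; trivial
    induction ha using Submodule.span_induction with
    | mem a ha => obtain ⟨x, rfl⟩ := ha; exact hm x
    | zero => simp
    | add a b _ _ ha hb => rw [add_mul, mul_add, ha, hb]
    | smul c a _ ha => rw [smul_mul_assoc, mul_smul_comm, ha]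
  obtain ⟨c, hc⟩ := (Algebra.IsCentral.mem_center_iff L).1 (Subalgebra.mem_center_iff.2 hall)
  exact ⟨c, by rw [hc, Algebra.algebraMap_eq_smul_one]⟩

theorem eq_algebraMap_of_form {x : X} {c : L}
    (h : IsBaseChange L φ.toLinearMap) (hx : φ x = c • 1) : ∃ a : K, x = algebraMap K X a := by
  have := mem_of_isBaseChange h (Submodule.span K {1}) (x := x) (by
    change φ x ∈ _
    rw [hx]
    refine Submodule.smul_mem _ _ (Submodule.subset_span ⟨1, ?_, ?_⟩)
    · exact Submodule.mem_span_singleton_self _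
    · exact map_one φ)
  obtain ⟨a, ha⟩ := Submodule.mem_span_singleton.1 this
  exact ⟨a, by rw [← ha, Algebra.algebraMap_eq_smul_one]⟩

theorem isCentral_of_form (h : IsBaseChange L φ.toLinearMap) : Algebra.IsCentral K X := by
  refine ⟨fun x hx => ?_⟩
  rw [Subalgebra.mem_center_iff] at hx
  obtain ⟨c, hc⟩ := exists_smul_one_of_commute (m := φ x) h
    fun y => by rw [← map_mul, ← map_mul, hx]
  obtain ⟨a, rfl⟩ := eq_algebraMap_of_form h hc
  exact Subalgebra.algebraMap_mem _ _

/-- A nonzero ideal spans over `L` a nonzero ideal of a simple matrix algebra, hence one containing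
`1`; by descent `1` already lies in the ideal. -/
theorem isSimpleRing_of_form [Nonempty I] (h : IsBaseChange L φ.toLinearMap) :
    IsSimpleRing X := by
  have hinj : Function.Injective φ := injective_of_isBaseChange h
  have : Nontrivial X := ⟨1, 0, fun h10 => one_ne_zero (α := Matrix I I L) (by
    rw [← map_one φ, h10, map_zero])⟩
  refine IsSimpleRing.of_eq_bot_or_eq_top fun J => ?_
  by_cases hJ : J = ⊥
  · exact Or.inl hJ
  right
  obtain ⟨z, hz, hz0⟩ : ∃ z ∈ J, z ≠ 0 := by
    by_contra! h
    exact hJ (eq_bot_iff.2 fun z hz => by simpa using h z hz)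
  let W : Submodule K X :=
    { carrier := J
      add_mem' := J.add_mem
      zero_mem' := J.zero_mem
      smul_mem' := fun c x hx => by
        rw [Algebra.smul_def]; exact J.mul_mem_left _ _ hx }
  let V := Submodule.span L (φ.toLinearMap '' W)
  have hVl : ∀ a, ∀ v ∈ V, a * v ∈ V := by
    intro a v hv
    induction hv using Submodule.span_induction with
    | mem v hv =>
      obtain ⟨w, hw, rfl⟩ := hv
      have ha : a ∈ Submodule.span L (Set.range φ.toLinearMap) := by
        rw [span_range_of_isBaseChange h]; trivial
      induction ha using Submodule.span_induction with
      | mem a ha =>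
        obtain ⟨x, rfl⟩ := ha
        exact Submodule.subset_span ⟨x * w, J.mul_mem_left _ _ hw, map_mul φ _ _⟩
      | zero => rw [zero_mul]; exact zero_mem _
      | add a b _ _ ha hb => rw [add_mul]; exact add_mem ha hb
      | smul c a _ ha => rw [smul_mul_assoc]; exact Submodule.smul_mem _ _ ha
    | zero => rw [mul_zero]; exact zero_mem _
    | add a b _ _ ha hb => rw [mul_add]; exact add_mem ha hb
    | smul c a _ ha => rw [mul_smul_comm]; exact Submodule.smul_mem _ _ ha
  have hVr : ∀ a, ∀ v ∈ V, v * a ∈ V := by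
    intro a v hv
    induction hv using Submodule.span_induction with
    | mem v hv =>
      obtain ⟨w, hw, rfl⟩ := hv
      have ha : a ∈ Submodule.span L (Set.range φ.toLinearMap) := by
        rw [span_range_of_isBaseChange h]; trivial
      induction ha using Submodule.span_induction with
      | mem a ha =>
        obtain ⟨x, rfl⟩ := ha
        exact Submodule.subset_span ⟨w * x, J.mul_mem_right _ _ hw, map_mul φ _ _⟩
      | zero => rw [mul_zero]; exact zero_mem _
      | add a b _ _ ha hb => rw [mul_add]; exact add_mem ha hb
      | smul c a _ ha => rw [mul_smul_comm]; exact Submodule.smul_mem _ _ ha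
    | zero => rw [zero_mul]; exact zero_mem _
    | add a b _ _ ha hb => rw [add_mul]; exact add_mem ha hb
    | smul c a _ ha => rw [smul_mul_assoc]; exact Submodule.smul_mem _ _ ha
  let J' : TwoSidedIdeal (Matrix I I L) := TwoSidedIdeal.mk' V V.zero_mem
    (fun ha hb => V.add_mem ha hb) (fun ha => V.neg_mem ha) (fun hy => hVl _ _ hy)
    (fun hy => hVr _ _ hy)
  have hJ' : ∀ m, m ∈ J' ↔ m ∈ V := fun m => TwoSidedIdeal.mem_mk' _ _ _ _ _ _ _
  have h1 : (1 : Matrix I I L) ∈ J' := IsSimpleRing.one_mem_of_ne_zero_mem J' (x := φ z)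
    (fun h0 => hz0 (hinj (by rw [h0, map_zero])))
    ((hJ' _).2 (Submodule.subset_span ⟨z, hz, rfl⟩))
  rw [hJ'] at h1
  have : (1 : X) ∈ W := mem_of_isBaseChange h W (by
    change φ 1 ∈ V
    rwa [map_one])
  exact (TwoSidedIdeal.one_mem_iff J).1 this

theorem finrank_of_form (h : IsBaseChange L φ.toLinearMap) :
    Module.finrank K X = Fintype.card I ^ 2 := by
  rw [← Module.finrank_baseChange (R := L), h.equiv.finrank_eq, Module.finrank_matrix]
  simp [sq]

end Form

/-- A finite-dimensional central simple algebra becomes a matrix algebra over an algebraically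
closed field. -/
theorem exists_form (K L S : Type*) [Field K] [Field L] [Algebra K L] [IsAlgClosed L] [Ring S]
    [Algebra K S] [FiniteDimensional K S] [IsSimpleRing S] [Algebra.IsCentral K S] :
    ∃ (n : ℕ) (_ : NeZero n) (φ : S →ₐ[K] Matrix (Fin n) (Fin n) L),
      IsBaseChange L φ.toLinearMap := by
  have h1 : IsSimpleRing (S ⊗[K] L) := isSimpleRing_tensor
  have h2 : IsSimpleRing (L ⊗[K] S) :=
    IsSimpleRing.of_ringEquiv (Algebra.TensorProduct.comm K S L).toRingEquiv h1
  obtain ⟨n, hn, ⟨e⟩⟩ := IsSimpleRing.exists_algEquiv_matrix_of_isAlgClosed L (L ⊗[K] S)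
  refine ⟨n, hn, (e.toAlgHom.restrictScalars K).comp Algebra.TensorProduct.includeRight, ?_⟩
  exact IsBaseChange.of_equiv e.toLinearEquiv fun x => rfl

/-! ### Kronecker products and permutations of the factors -/

section Kron

variable {L : Type*} [Field L] {n k : ℕ}

/-- The Kronecker product of `k` square matrices of size `n`. -/
def kron (x : Fin k → Matrix (Fin n) (Fin n) L) :
    Matrix (Fin k → Fin n) (Fin k → Fin n) L :=
  Matrix.of fun f g => ∏ i, x i (f i) (g i)

theorem kron_apply (x : Fin k → Matrix (Fin n) (Fin n) L) (f g : Fin k → Fin n) :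
    kron x f g = ∏ i, x i (f i) (g i) := rfl

theorem kron_mul (x y : Fin k → Matrix (Fin n) (Fin n) L) :
    kron (x * y) = kron x * kron y := by
  ext f g
  simp only [kron_apply, Matrix.mul_apply, Pi.mul_apply, Finset.prod_univ_sum,
    Fintype.piFinset_univ, Finset.prod_mul_distrib]

theorem kron_one : kron (1 : Fin k → Matrix (Fin n) (Fin n) L) = 1 := by
  ext f g
  simp only [kron_apply, Pi.one_apply, Matrix.one_apply, Finset.prod_ite_zero, Finset.prod_const_one,
    funext_iff, Finset.mem_univ, true_implies]

/-- The matrix which permutes the `k` tensor factors by `σ`. -/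
def permMat (L : Type*) [Field L] (n : ℕ) {k : ℕ} (σ : Equiv.Perm (Fin k)) :
    Matrix (Fin k → Fin n) (Fin k → Fin n) L :=
  Matrix.of fun f g => if f = g ∘ σ then 1 else 0

theorem mul_permMat_apply (σ : Equiv.Perm (Fin k)) (m : Matrix (Fin k → Fin n) (Fin k → Fin n) L)
    (f g : Fin k → Fin n) : (m * permMat L n σ) f g = m f (g ∘ σ) := by
  simp [Matrix.mul_apply, permMat]

/-- Right multiplication precomposes column indices with the permutation, which reverses the order
of composition. -/
theorem permMat_mul (σ τ : Equiv.Perm (Fin k)) :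
    permMat L n σ * permMat L n τ = permMat L n (τ * σ) := by
  ext f g
  rw [mul_permMat_apply]
  rfl

theorem permMat_one : permMat L n (1 : Equiv.Perm (Fin k)) = 1 := by
  ext f g
  simp [permMat, Matrix.one_apply]

theorem permMat_mul_apply (σ : Equiv.Perm (Fin k)) (m : Matrix (Fin k → Fin n) (Fin k → Fin n) L)
    (f g : Fin k → Fin n) : (permMat L n σ * m) f g = m (f ∘ σ.symm) g := by
  have : ∀ h : Fin k → Fin n, f = h ∘ σ ↔ h = f ∘ σ.symm := by
    intro h
    constructor
    · rintro rfl; ext; simp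
    · rintro rfl; ext; simp
  simp [Matrix.mul_apply, permMat, this]

/-- This intertwining relation determines the permutation matrix up to a scalar, which is what
allows its descent to `K`. -/
theorem kron_mul_permMat (σ : Equiv.Perm (Fin k)) (x : Fin k → Matrix (Fin n) (Fin n) L) :
    kron x * permMat L n σ = permMat L n σ * kron (x ∘ σ.symm) := by
  ext f g
  rw [mul_permMat_apply, permMat_mul_apply, kron_apply, kron_apply]
  rw [← Equiv.prod_comp σ.symm]
  simp

end Kron

/-! ### Tensor powers of a form, and descent of the permutation matrices -/

section TensorPower

variable {K L S : Type*} [Field K] [Field L] [Algebra K L] [Ring S] [Algebra K S] {n : ℕ}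

/-- The representation of the `k`-th tensor power of an algebra on the `k`-th tensor power of the
representation `φ`. -/
noncomputable def kronHom (φ : S →ₐ[K] Matrix (Fin n) (Fin n) L) (k : ℕ) :
    (⨂[K] _ : Fin k, S) →ₐ[K] Matrix (Fin k → Fin n) (Fin k → Fin n) L :=
  PiTensorProduct.liftAlgHom
    { toFun := fun x => kron fun i => φ (x i)
      map_update_add' := by
        intro inst m i x y
        obtain rfl := Subsingleton.elim inst (instDecidableEqFin k)
        ext f g
        have : ∀ z, ∏ j, φ (Function.update m i z j) (f j) (g j) =
            φ z (f i) (g i) * ∏ j ∈ Finset.univ.erase i, φ (m j) (f j) (g j) := by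
          intro z
          rw [← Finset.mul_prod_erase _ _ (Finset.mem_univ i), Function.update_self]
          congr 1
          refine Finset.prod_congr rfl fun j hj => ?_
          rw [Function.update_of_ne (Finset.ne_of_mem_erase hj)]
        simp [kron_apply, this, add_mul]
      map_update_smul' := by
        intro inst m i c x
        obtain rfl := Subsingleton.elim inst (instDecidableEqFin k)
        ext f g
        have : ∀ z, ∏ j, φ (Function.update m i z j) (f j) (g j) =
            φ z (f i) (g i) * ∏ j ∈ Finset.univ.erase i, φ (m j) (f j) (g j) := by
          intro z
          rw [← Finset.mul_prod_erase _ _ (Finset.mem_univ i), Function.update_self]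
          congr 1
          refine Finset.prod_congr rfl fun j hj => ?_
          rw [Function.update_of_ne (Finset.ne_of_mem_erase hj)]
        simp [kron_apply, this] }
    (by
      change kron (fun _ => φ 1) = 1
      rw [map_one]
      exact kron_one)
    (by
      intro x y
      change kron (fun i => φ (x i * y i)) = kron (fun i => φ (x i)) * kron (fun i => φ (y i))
      rw [← kron_mul]
      congr 1
      funext i
      simp)

theorem kronHom_tprod (φ : S →ₐ[K] Matrix (Fin n) (Fin n) L) (k : ℕ) (x : Fin k → S) :
    kronHom φ k (PiTensorProduct.tprod K x) = kron fun i => φ (x i) :=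
  PiTensorProduct.lift.tprod x

instance finite_tensorPower [FiniteDimensional K S] (k : ℕ) :
    FiniteDimensional K (⨂[K] _ : Fin k, S) :=
  Module.Basis.finiteDimensional_of_finite (Basis.piTensorProduct fun _ => Module.finBasis K S)

theorem finrank_tensorPower [FiniteDimensional K S] (k : ℕ) :
    Module.finrank K (⨂[K] _ : Fin k, S) = Module.finrank K S ^ k := by
  rw [Module.finrank_eq_card_basis (Basis.piTensorProduct fun _ : Fin k => Module.finBasis K S)]
  simp

theorem isBaseChange_kronHom [FiniteDimensional K S] {φ : S →ₐ[K] Matrix (Fin n) (Fin n) L}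
    (h : IsBaseChange L φ.toLinearMap) (k : ℕ) :
    IsBaseChange L (kronHom φ k).toLinearMap := by
  apply isBaseChange_of_span
  · have hsingle : ∀ f g : Fin k → Fin n, Matrix.single f g (1 : L) ∈
        Submodule.span L (Set.range (kronHom φ k).toLinearMap) := by
      intro f g
      let b := Module.finBasis K S
      have hb : ∀ m : Matrix (Fin n) (Fin n) L, ∃ l : Fin (Module.finrank K S) → L,
          ∑ j, l j • φ (b j) = m := by
        intro m
        rw [← Submodule.mem_span_range_iff_exists_fun]
        have hm : m ∈ Submodule.span L (Set.range φ.toLinearMap) := by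
          rw [span_range_of_isBaseChange h]; trivial
        refine Submodule.span_le.2 ?_ hm
        rintro _ ⟨x, rfl⟩
        change φ x ∈ _
        rw [← b.sum_repr x, map_sum]
        refine Submodule.sum_mem _ fun j _ => ?_
        rw [map_smul, ← algebraMap_smul L]
        exact Submodule.smul_mem _ _ (Submodule.subset_span ⟨j, rfl⟩)
      choose l hl using fun i => hb (Matrix.single (f i) (g i) 1)
      -- A matrix unit is a Kronecker product of matrix units; expand each of these in the spanning
      -- family `φ (b j)` and multiply out.
      have : Matrix.single f g (1 : L) = ∑ J : Fin k → Fin (Module.finrank K S),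
          (∏ i, l i (J i)) • kronHom φ k (PiTensorProduct.tprod K fun i => b (J i)) := by
        ext f' g'
        have h1 : Matrix.single f g (1 : L) f' g' =
            ∏ i, Matrix.single (f i) (g i) (1 : L) (f' i) (g' i) := by
          simp only [Matrix.single_apply, Finset.prod_ite_zero, Finset.prod_const_one,
            funext_iff, Finset.mem_univ, true_implies, forall_and]
        rw [h1]
        simp only [← hl, Matrix.sum_apply, Finset.prod_univ_sum, Fintype.piFinset_univ,
          Matrix.smul_apply, smul_eq_mul, Finset.prod_mul_distrib, kronHom_tprod, kron_apply]
      rw [this]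
      exact Submodule.sum_mem _ fun J _ => Submodule.smul_mem _ _
        (Submodule.subset_span ⟨PiTensorProduct.tprod K fun i => b (J i), rfl⟩)
    rw [eq_top_iff]
    intro m _
    rw [Matrix.matrix_eq_sum_single m]
    refine Submodule.sum_mem _ fun f _ => Submodule.sum_mem _ fun g _ => ?_
    have : Matrix.single f g (m f g) = m f g • Matrix.single f g (1 : L) := by simp
    rw [this]
    exact Submodule.smul_mem _ _ (hsingle f g)
  · rw [finrank_tensorPower, finrank_of_form h, Module.finrank_matrix]
    simp [sq, mul_pow]

/-- The intertwining equations are linear with coefficients in `K` and have the nonzero solution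
`permMat L n σ` over `L`, so they have a nonzero solution `w` over `K`. The image of `w` times the
inverse of the permutation matrix commutes with everything, so it is a scalar. -/
theorem exists_smul_permMat_mem [FiniteDimensional K S] {φ : S →ₐ[K] Matrix (Fin n) (Fin n) L}
    [NeZero n] (h : IsBaseChange L φ.toLinearMap) {k : ℕ} (σ : Equiv.Perm (Fin k)) :
    ∃ c : L, c ≠ 0 ∧ c • permMat L n σ ∈ (kronHom φ k).range := by
  have hk := isBaseChange_kronHom h k
  let t := fun x : Fin k → S => PiTensorProduct.tprod K x
  let g : (Fin k → S) → (⨂[K] _ : Fin k, S) →ₗ[K] (⨂[K] _ : Fin k, S) := fun x =>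
    LinearMap.mulLeft K (t x) - LinearMap.mulRight K (t (x ∘ σ.symm))
  let g' : (Fin k → S) → Matrix (Fin k → Fin n) (Fin k → Fin n) L →ₗ[L]
      Matrix (Fin k → Fin n) (Fin k → Fin n) L := fun x =>
    LinearMap.mulLeft L (kronHom φ k (t x)) - LinearMap.mulRight L (kronHom φ k (t (x ∘ σ.symm)))
  have hspan := span_iInf_ker hk g g' (by intro x y; simp [g, g'])
  have hP : permMat L n σ ∈ ⨅ x, LinearMap.ker (g' x) := by
    simp only [Submodule.mem_iInf, LinearMap.mem_ker]
    intro x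
    simp only [g', t, LinearMap.sub_apply, LinearMap.mulLeft_apply, LinearMap.mulRight_apply,
      kronHom_tprod, kron_mul_permMat, sub_eq_zero]
    rfl
  have hinv : permMat L n σ⁻¹ * permMat L n σ = 1 := by simp [permMat_mul, permMat_one]
  have hinv' : permMat L n σ * permMat L n σ⁻¹ = 1 := by simp [permMat_mul, permMat_one]
  have hP0 : permMat L n σ ≠ 0 := by
    intro h0
    rw [h0, zero_mul] at hinv'
    exact zero_ne_one hinv'
  obtain ⟨w, hw, hw0⟩ : ∃ w ∈ (⨅ x, LinearMap.ker (g x) : Submodule K _), w ≠ 0 := by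
    by_contra! hall
    rw [← hspan] at hP
    have hz : Submodule.span L ((kronHom φ k).toLinearMap ''
        (⨅ x, LinearMap.ker (g x) : Submodule K _)) ≤ ⊥ := by
      rw [Submodule.span_le]
      rintro _ ⟨w, hw, rfl⟩
      simp [hall w hw]
    exact hP0 (by simpa using hz hP)
  simp only [Submodule.mem_iInf, LinearMap.mem_ker, g, LinearMap.sub_apply,
    LinearMap.mulLeft_apply, LinearMap.mulRight_apply, sub_eq_zero] at hw
  have hcomm : ∀ z, kronHom φ k z * (kronHom φ k w * permMat L n σ⁻¹) =
      kronHom φ k w * permMat L n σ⁻¹ * kronHom φ k z := by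
    intro z
    induction z using PiTensorProduct.induction_on with
    | smul_tprod r x =>
      simp only [map_smul, smul_mul_assoc, mul_smul_comm]
      congr 1
      rw [← mul_assoc, ← map_mul]
      change kronHom φ k (t x * w) * _ = _
      rw [hw, map_mul, mul_assoc, mul_assoc]
      congr 1
      simp only [t, kronHom_tprod]
      rw [kron_mul_permMat]
      congr 2
      funext i
      exact (congrArg (fun j => φ (x j)) (σ.symm_apply_apply i))
    | add a b ha hb => rw [map_add, add_mul, mul_add, ha, hb]
  obtain ⟨c, hc⟩ := exists_smul_one_of_commute hk hcomm
  have hcw : kronHom φ k w = c • permMat L n σ := by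
    have := congrArg (· * permMat L n σ) hc
    simpa [mul_assoc, hinv] using this
  refine ⟨c, fun h0 => hw0 ?_, ⟨w, hcw⟩⟩
  apply injective_of_isBaseChange hk
  change kronHom φ k w = kronHom φ k 0
  rw [hcw, h0, zero_smul, map_zero]

/-- The scalars `c σ` need not come from `K`, but each product `c σ * c σ⁻¹` does, and only such
products appear in a commutator. This is why the commutator subgroup replaces the full symmetric
group. -/
theorem permMat_mem_of_mem_commutator [FiniteDimensional K S]
    {φ : S →ₐ[K] Matrix (Fin n) (Fin n) L}
    [NeZero n] (h : IsBaseChange L φ.toLinearMap) {k : ℕ} {σ : Equiv.Perm (Fin k)}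
    (hσ : σ ∈ commutator (Equiv.Perm (Fin k))) :
    permMat L n σ ∈ (kronHom φ k).range := by
  have hk := isBaseChange_kronHom h k
  choose c hc0 hc using fun σ : Equiv.Perm (Fin k) => exists_smul_permMat_mem h σ
  -- If `l • 1` is in the image, then `l` comes from `K` and can be cancelled there.
  have hcan : ∀ (l : L), l ≠ 0 → l • (1 : Matrix (Fin k → Fin n) (Fin k → Fin n) L) ∈
      (kronHom φ k).range → ∀ m, l • m ∈ (kronHom φ k).range → m ∈ (kronHom φ k).range := by
    rintro l hl ⟨x, hx⟩ m ⟨y, hy⟩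
    obtain ⟨a, rfl⟩ := eq_algebraMap_of_form hk hx
    have hal : algebraMap K L a = l := by
      have hx' : algebraMap K (Matrix (Fin k → Fin n) (Fin k → Fin n) L) a = l • 1 := by
        rw [← hx]; exact ((kronHom φ k).commutes a).symm
      have := congrFun (congrFun hx' 0) 0
      simpa [Matrix.algebraMap_matrix_apply] using this
    have ha : a ≠ 0 := by rintro rfl; simp at hal; exact hl hal.symm
    refine ⟨a⁻¹ • y, ?_⟩
    change kronHom φ k (a⁻¹ • y) = m
    rw [map_smul]
    change a⁻¹ • (kronHom φ k).toRingHom y = m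
    rw [hy, ← hal, ← algebraMap_smul L a⁻¹ (_ • m), smul_smul, map_inv₀,
      inv_mul_cancel₀ (by rw [hal]; exact hl), one_smul]
  have hinv : ∀ σ, (c σ * c σ⁻¹) • (1 : Matrix (Fin k → Fin n) (Fin k → Fin n) L) ∈
      (kronHom φ k).range := by
    intro σ
    have := mul_mem (hc σ) (hc σ⁻¹)
    rwa [smul_mul_smul_comm, permMat_mul, inv_mul_cancel, permMat_one] at this
  rw [commutator_eq_closure] at hσ
  induction hσ using Subgroup.closure_induction with
  | mem σ hσ =>
    obtain ⟨a, b, rfl⟩ := hσ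
    refine hcan ((c a * c a⁻¹) * (c b * c b⁻¹)) (by simp [hc0]) ?_ _ ?_
    · have := mul_mem (hinv a) (hinv b)
      rwa [smul_mul_smul_comm, one_mul] at this
    -- The factors stand in reverse order because `permMat` reverses products.
    · have := mul_mem (mul_mem (hc b⁻¹) (hc a⁻¹)) (mul_mem (hc b) (hc a))
      simp only [smul_mul_smul_comm, permMat_mul] at this
      rw [commutatorElement_def]
      convert this using 2
      · ring
      · simp [mul_assoc]
  | one => rw [permMat_one]; exact one_mem _
  | mul a b _ _ ha hb => rw [← permMat_mul]; exact mul_mem hb ha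
  | inv a _ ha =>
    have h1 := mul_mem ha (hc a⁻¹)
    rw [mul_smul_comm, permMat_mul, inv_mul_cancel, permMat_one] at h1
    exact hcan _ (hc0 _) h1 _ (hc a⁻¹)

end TensorPower

/-! ### Counting index functions up to permutation -/

section Sym

variable {n k : ℕ}

/-- The multiset of values of a function. -/
def symOf (g : Fin k → Fin n) : Sym (Fin n) k :=
  ⟨Finset.univ.val.map g, by simp⟩

theorem symOf_surjective : Function.Surjective (symOf : (Fin k → Fin n) → Sym (Fin n) k) := by
  rintro ⟨s, hs⟩
  induction s using Quotient.inductionOn with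
  | h l =>
    have hl : l.length = k := hs
    subst hl
    refine ⟨l.get, Subtype.ext ?_⟩
    change Finset.univ.val.map l.get = (l : Multiset (Fin n))
    rw [Fin.univ_val_map, List.ofFn_get]

theorem exists_perm_of_symOf_eq {f g : Fin k → Fin n} (h : symOf f = symOf g) :
    ∃ σ : Equiv.Perm (Fin k), f = g ∘ σ := by
  have hcard : ∀ c, Fintype.card {a // f a = c} = Fintype.card {a // g a = c} := by
    intro c
    have h1 := congrArg (fun s : Sym (Fin n) k => Multiset.count c s.1) h
    simp only [symOf, Multiset.count_map] at h1
    rw [Fintype.card_subtype, Fintype.card_subtype]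
    simpa [Finset.card_def, eq_comm] using h1
  refine ⟨Equiv.ofFiberEquiv fun c => Fintype.equivOfCardEq (hcard c), ?_⟩
  funext a
  exact (Equiv.ofFiberEquiv_map _ a).symm

theorem symOf_comp (σ : Equiv.Perm (Fin k)) (g : Fin k → Fin n) : symOf (g ∘ σ) = symOf g := by
  apply Subtype.ext
  change Finset.univ.val.map (g ∘ σ) = Finset.univ.val.map g
  rw [← Multiset.map_map]
  congr 1
  simp

/-- As `n < k`, `g` takes the same value at two positions; exchanging them leaves `g` unchanged and
corrects the sign. The bound `5 ≤ k` serves to identify the commutator subgroup with the alternating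
group. -/
theorem exists_even_perm_of_symOf_eq {f g : Fin k → Fin n} (hk : 5 ≤ k) (hnk : n < k)
    (h : symOf f = symOf g) :
    ∃ σ ∈ commutator (Equiv.Perm (Fin k)), f = g ∘ σ := by
  rw [alternatingGroup.commutator_perm_eq (by simpa using hk)]
  obtain ⟨σ, hσ⟩ := exists_perm_of_symOf_eq h
  rcases Int.units_eq_one_or (Equiv.Perm.sign σ) with h1 | h1
  · exact ⟨σ, Equiv.Perm.mem_alternatingGroup.2 h1, hσ⟩
  · obtain ⟨i, j, hij, hg⟩ := Fintype.exists_ne_map_eq_of_card_lt g (by simpa using hnk)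
    refine ⟨Equiv.swap i j * σ, ?_, ?_⟩
    · rw [Equiv.Perm.mem_alternatingGroup, map_mul, h1, Equiv.Perm.sign_swap hij]
      rfl
    · rw [hσ]
      funext a
      simp only [Function.comp_apply, Equiv.Perm.mul_apply]
      by_cases hi : σ a = i
      · rw [hi, Equiv.swap_apply_left, hg]
      · by_cases hj : σ a = j
        · rw [hj, Equiv.swap_apply_right, hg]
        · rw [Equiv.swap_apply_of_ne_of_ne hi hj]

/-- A fixed matrix is one whose entry at `(f, g)` depends on `g` only through its multiset of
values. Counting invariants directly, without averaging over the group, makes this valid in every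
characteristic. -/
theorem finrank_permMat_fixed (L : Type*) [Field L] (hk : 5 ≤ k) (hnk : n < k) :
    Module.finrank L (⨅ σ : commutator (Equiv.Perm (Fin k)),
      LinearMap.ker (LinearMap.mulRight L (permMat L n (σ : Equiv.Perm (Fin k))) - 1) :
        Submodule L (Matrix (Fin k → Fin n) (Fin k → Fin n) L)) =
      n ^ k * (n + k - 1).choose k := by
  let Ψ : ((Fin k → Fin n) × Sym (Fin n) k → L) →ₗ[L]
      Matrix (Fin k → Fin n) (Fin k → Fin n) L :=
    { toFun := fun F => Matrix.of fun f g => F (f, symOf g)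
      map_add' := fun _ _ => rfl
      map_smul' := fun _ _ => rfl }
  have hinj : Function.Injective Ψ := by
    intro F G h
    funext ⟨f, s⟩
    obtain ⟨g, rfl⟩ := symOf_surjective s
    exact congrFun (congrFun h f) g
  have hr : LinearMap.range Ψ = ⨅ σ : commutator (Equiv.Perm (Fin k)),
      LinearMap.ker (LinearMap.mulRight L (permMat L n (σ : Equiv.Perm (Fin k))) - 1) := by
    ext m
    simp only [Submodule.mem_iInf, LinearMap.mem_ker, LinearMap.sub_apply,
      LinearMap.mulRight_apply, sub_eq_zero, Module.End.one_apply]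
    constructor
    · rintro ⟨F, rfl⟩ σ
      ext f g
      rw [mul_permMat_apply]
      change F (f, symOf (g ∘ _)) = F (f, symOf g)
      rw [symOf_comp]
    · intro hm
      refine ⟨fun p => m p.1 (Function.surjInv symOf_surjective p.2), ?_⟩
      ext f g
      change m f (Function.surjInv symOf_surjective (symOf g)) = m f g
      obtain ⟨σ, hσ, h⟩ := exists_even_perm_of_symOf_eq hk hnk
        (Function.surjInv_eq symOf_surjective (symOf g))
      rw [h]
      exact (mul_permMat_apply σ m f g).symm.trans (congrFun (congrFun (hm ⟨σ, hσ⟩) f) g)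
  rw [← hr, LinearMap.finrank_range_of_inj hinj, Module.finrank_fintype_fun_eq_card,
    Fintype.card_prod, Sym.card_sym_eq_choose]
  simp

end Sym

/-- The elements fixed by right multiplication by the descended permutations `u σ` form a left
ideal. Over `L` it becomes the space of matrices whose rows are symmetric tensors, which gives its
dimension. -/
theorem hasRep_tensorPower {K L S : Type*} [Field K] [Field L] [Algebra K L] [Ring S] [Algebra K S]
    {n : ℕ} [NeZero n] [FiniteDimensional K S] {φ : S →ₐ[K] Matrix (Fin n) (Fin n) L}
    (h : IsBaseChange L φ.toLinearMap) {k : ℕ} (hk : 5 ≤ k) (hnk : n < k) :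
    HasRep K (⨂[K] _ : Fin k, S) (n ^ k * (n + k - 1).choose k) := by
  have hk' := isBaseChange_kronHom h k
  choose u hu using fun σ : commutator (Equiv.Perm (Fin k)) =>
    permMat_mem_of_mem_commutator h σ.2
  let g : commutator (Equiv.Perm (Fin k)) → (⨂[K] _ : Fin k, S) →ₗ[K] (⨂[K] _ : Fin k, S) :=
    fun σ => LinearMap.mulRight K (u σ) - 1
  let W : Submodule K (⨂[K] _ : Fin k, S) := ⨅ σ, LinearMap.ker (g σ)
  have hW : ∀ x, x ∈ W ↔ ∀ σ, x * u σ = x := by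
    intro x
    simp [W, g, sub_eq_zero]
  have hfin : Module.finrank K W = n ^ k * (n + k - 1).choose k := by
    rw [← finrank_permMat_fixed L hk hnk, ← finrank_span_of_isBaseChange hk' W]
    rw [span_iInf_ker hk' g (fun σ : commutator (Equiv.Perm (Fin k)) =>
      LinearMap.mulRight L (permMat L n (σ : Equiv.Perm (Fin k))) - 1)]
    intro σ x
    have : kronHom φ k (u σ) = permMat L n (σ : Equiv.Perm (Fin k)) := hu σ
    simp [g, this]
  have hinv : ∀ a, ∀ w ∈ W, LinearMap.mulLeft K a w ∈ W := by
    intro a w hw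
    rw [hW] at hw ⊢
    intro σ
    rw [LinearMap.mulLeft_apply, mul_assoc, hw]
  let ρ : (⨂[K] _ : Fin k, S) →ₐ[K] Module.End K W :=
    { toFun := fun a => (LinearMap.mulLeft K a).restrict (hinv a)
      map_one' := by ext; simp
      map_mul' := fun a b => by ext; simp
      map_zero' := by ext; simp
      map_add' := fun a b => by ext; simp [add_mul]
      commutes' := fun c => by ext; simp [Module.algebraMap_end_apply, Algebra.smul_def] }
  rw [← hfin]
  exact hasRep_of_end ρ

/-! ### The underlying division algebra and a binomial coefficient -/

section Index

universe v

variable {K : Type*} {X : Type v} [Field K] [Ring X] [Algebra K X]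

/-- Wedderburn's theorem in terms of the dimensions of representations. -/
theorem exists_matrix_division {N : ℕ} [FiniteDimensional K X] [IsSimpleRing X]
    [Algebra.IsCentral K X] (hN : Module.finrank K X = N ^ 2) :
    ∃ (r t : ℕ) (T : Type v) (_ : DivisionRing T) (_ : Algebra K T), NeZero r ∧
      FiniteDimensional K T ∧ Algebra.IsCentral K T ∧
      Nonempty (X ≃ₐ[K] Matrix (Fin r) (Fin r) T) ∧ Module.finrank K T = t ^ 2 ∧ r * t = N := by
  have := IsArtinianRing.of_finite K X
  obtain ⟨r, hr, T, _, _, _, ⟨e⟩⟩ := IsSimpleRing.exists_algEquiv_matrix_divisionRing_finite K X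
  have hd : N ^ 2 = r ^ 2 * Module.finrank K T := by
    rw [← hN, e.toLinearEquiv.finrank_eq, Module.finrank_matrix]
    simp [sq]
  have hrN : r ∣ N := (Nat.pow_dvd_pow_iff two_ne_zero).1 ⟨_, hd⟩
  obtain ⟨t, rfl⟩ := hrN
  refine ⟨r, t, T, inferInstance, inferInstance, hr, inferInstance, ?_, ⟨e⟩, ?_, rfl⟩
  · have hc : Algebra.IsCentral K (Matrix (Fin r) (Fin r) T) := Algebra.IsCentral.of_algEquiv K _ _ e
    refine ⟨fun z hz => ?_⟩
    rw [Subalgebra.mem_center_iff] at hz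
    have hz' : (Matrix.scalar (Fin r) z) ∈ Subalgebra.center K (Matrix (Fin r) (Fin r) T) := by
      rw [Subalgebra.mem_center_iff]
      intro m
      ext i j
      simp [hz]
    obtain ⟨a, ha⟩ := (Algebra.IsCentral.mem_center_iff K).1 hz'
    have := congrFun (congrFun ha 0) 0
    simp [Matrix.algebraMap_matrix_apply] at this
    rw [this]
    exact Subalgebra.algebraMap_mem _ _
  · rw [mul_pow] at hd
    exact (Nat.eq_of_mul_eq_mul_left (pow_pos (NeZero.pos r) 2) hd).symm

end Index

/-- Kummer's theorem: adding `n - 1 < q ^ c` to `q ^ c` in base `q` produces no carry. -/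
theorem not_dvd_choose {q c n : ℕ} (hq : q.Prime) (hn : 0 < n) (h : n ≤ q ^ c) :
    ¬ q ∣ (n + q ^ c - 1).choose (q ^ c) := by
  have : Fact q.Prime := ⟨hq⟩
  have e : n + q ^ c - 1 = (n - 1) + q ^ c := by omega
  rw [e]
  have hv : padicValNat q (((n - 1) + q ^ c).choose (q ^ c)) = 0 := by
    rw [padicValNat_choose' (Nat.lt_succ_self _), Finset.card_eq_zero, Finset.filter_eq_empty_iff]
    intro i _
    rw [not_le]
    have hpos : 0 < q ^ i := pow_pos hq.pos i
    rcases le_or_gt i c with hic | hic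
    · rw [Nat.mod_eq_zero_of_dvd (pow_dvd_pow q hic), zero_add]
      exact Nat.mod_lt _ hpos
    · have h1 : 2 * q ^ c ≤ q ^ i := by
        calc 2 * q ^ c ≤ q * q ^ c := Nat.mul_le_mul_right _ hq.two_le
          _ = q ^ (c + 1) := by ring
          _ ≤ q ^ i := Nat.pow_le_pow_right hq.pos hic
      have h2 := Nat.mod_le (q ^ c) (q ^ i)
      have h3 := Nat.mod_le (n - 1) (q ^ i)
      have h4 : 0 < q ^ c := pow_pos hq.pos c
      omega
  intro hdvd
  have hpos : ((n - 1) + q ^ c).choose (q ^ c) ≠ 0 := (Nat.choose_pos (Nat.le_add_left _ _)).ne'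
  exact (one_le_padicValNat_of_dvd hpos hdvd).not_gt (by omega)

/-! ### Representations of tensor powers -/

section Lift

variable {K S Y : Type*} [Field K] [Ring S] [Algebra K S] [Ring Y] [Algebra K Y]

theorem prod_ofFn_mul {M : Type*} [Monoid M] {k : ℕ} (a b : Fin k → M)
    (h : ∀ i j, i ≠ j → Commute (b i) (a j)) :
    (List.ofFn fun i => a i * b i).prod = (List.ofFn a).prod * (List.ofFn b).prod := by
  induction k with
  | zero => simp
  | succ k ih =>
    simp only [List.ofFn_succ, List.prod_cons]
    rw [ih (fun i => a i.succ) (fun i => b i.succ)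
      fun i j hij => h _ _ fun e => hij (Fin.succ_injective _ e)]
    have hc : Commute (b 0) (List.ofFn fun i : Fin k => a i.succ).prod := by
      apply Commute.list_prod_right
      intro x hx
      obtain ⟨i, rfl⟩ := (List.mem_ofFn' _ _).1 hx
      exact h 0 i.succ (Fin.succ_ne_zero i).symm
    simp only [mul_assoc]
    rw [← mul_assoc (b 0), hc.eq]
    simp only [mul_assoc]

/-- A family of `k` commuting homomorphisms from `S` gives a homomorphism from the tensor power. -/
noncomputable def tensorPowerLift {k : ℕ} (f : Fin k → S →ₐ[K] Y)
    (hf : ∀ i j, i ≠ j → ∀ x y, Commute (f i x) (f j y)) : (⨂[K] _ : Fin k, S) →ₐ[K] Y :=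
  PiTensorProduct.liftAlgHom
    ((MultilinearMap.mkPiAlgebraFin K k Y).compLinearMap fun i => (f i).toLinearMap)
    (by simp) (by
      intro x y
      simp only [MultilinearMap.compLinearMap_apply, MultilinearMap.mkPiAlgebraFin_apply,
        AlgHom.toLinearMap_apply, Pi.mul_apply, map_mul]
      exact prod_ofFn_mul _ _ fun i j hij => hf i j hij _ _)

theorem commute_single {k : ℕ} {i j : Fin k} (hij : i ≠ j) (x y : S) :
    Commute (PiTensorProduct.singleAlgHom (R := K) (A := fun _ : Fin k => S) i x)
      (PiTensorProduct.singleAlgHom (R := K) (A := fun _ : Fin k => S) j y) := by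
  apply Commute.tprod
  exact Pi.mulSingle_commute (f := fun _ : Fin k => S) hij x y

/-- The homomorphism from the `k + 1`-st tensor power to `S ⊗ S^{⊗ k}`. -/
noncomputable def tensorPowerSucc (K S : Type*) [Field K] [Ring S] [Algebra K S] (k : ℕ) :
    (⨂[K] _ : Fin (k + 1), S) →ₐ[K] S ⊗[K] (⨂[K] _ : Fin k, S) :=
  tensorPowerLift
    (Fin.cases Algebra.TensorProduct.includeLeft fun i =>
      (Algebra.TensorProduct.includeRight).comp (PiTensorProduct.singleAlgHom (R := K) (A := fun _ : Fin k => S) i))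
    (by
      intro i j
      refine Fin.cases ?_ (fun i => ?_) i <;> refine Fin.cases ?_ (fun j => ?_) j
      · exact fun h => absurd rfl h
      · intro _ x y
        simp [Commute, SemiconjBy, -PiTensorProduct.singleAlgHom_apply]
      · intro _ x y
        simp [Commute, SemiconjBy, -PiTensorProduct.singleAlgHom_apply]
      · intro h x y
        exact (commute_single (fun e => h (congrArg Fin.succ e)) x y).map
          Algebra.TensorProduct.includeRight)

/-- The homomorphism from the `j + k`-th tensor power to `S^{⊗ j} ⊗ S^{⊗ k}`. -/
noncomputable def tensorPowerAdd (K S : Type*) [Field K] [Ring S] [Algebra K S] (j k : ℕ) :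
    (⨂[K] _ : Fin (j + k), S) →ₐ[K] (⨂[K] _ : Fin j, S) ⊗[K] (⨂[K] _ : Fin k, S) :=
  tensorPowerLift
    (Fin.addCases (fun i => (Algebra.TensorProduct.includeLeft).comp
        (PiTensorProduct.singleAlgHom (R := K) (A := fun _ : Fin j => S) i)) fun i =>
      (Algebra.TensorProduct.includeRight).comp (PiTensorProduct.singleAlgHom (R := K) (A := fun _ : Fin k => S) i))
    (by
      intro a b
      refine Fin.addCases (fun a => ?_) (fun a => ?_) a <;>
        refine Fin.addCases (fun b => ?_) (fun b => ?_) b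
      · intro h x y
        simp only [Fin.addCases_left]
        exact (commute_single (fun e => h (by rw [e])) x y).map
          (Algebra.TensorProduct.includeLeft (R := K) (S := K))
      · intro _ x y
        simp [Commute, SemiconjBy, -PiTensorProduct.singleAlgHom_apply]
      · intro _ x y
        simp [Commute, SemiconjBy, -PiTensorProduct.singleAlgHom_apply]
      · intro h x y
        simp only [Fin.addCases_right]
        exact (commute_single (fun e => h (by rw [e])) x y).map Algebra.TensorProduct.includeRight)

/-- Exchange the last two factors of a tensor product of algebras. -/
noncomputable def tensorRightComm (K A B C : Type*) [Field K] [Ring A] [Algebra K A] [Ring B]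
    [Algebra K B] [Ring C] [Algebra K C] : (A ⊗[K] B) ⊗[K] C →ₐ[K] (A ⊗[K] C) ⊗[K] B :=
  (Algebra.TensorProduct.assoc K K K A C B).symm.toAlgHom.comp
    ((Algebra.TensorProduct.map (AlgHom.id K A) (Algebra.TensorProduct.comm K B C).toAlgHom).comp
      (Algebra.TensorProduct.assoc K K K A B C).toAlgHom)

theorem HasRep.tensorPower_mul {k d : ℕ} (h : HasRep K (⨂[K] _ : Fin k, S) d) (m : ℕ) :
    HasRep K (⨂[K] _ : Fin (k * m), S) (d ^ m) := by
  induction m with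
  | zero => exact ⟨tensorPowerLift (fun i => i.elim0) fun i => i.elim0⟩
  | succ m ih =>
    rw [pow_succ]
    exact (ih.tensor h).comp (tensorPowerAdd K S (k * m) k)

theorem HasRep.tensorPower_succ_tensor {k d e : ℕ} (h : HasRep K (S ⊗[K] Y) d)
    (h' : HasRep K (⨂[K] _ : Fin k, S) e) :
    HasRep K ((⨂[K] _ : Fin (k + 1), S) ⊗[K] Y) (d * e) :=
  (h.tensor h').comp ((tensorRightComm K S (⨂[K] _ : Fin k, S) Y).comp
    (Algebra.TensorProduct.map (tensorPowerSucc K S k) (AlgHom.id K Y)))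

theorem HasRep.tensorPower_succ {k d e : ℕ} (h : HasRep K S d)
    (h' : HasRep K (⨂[K] _ : Fin k, S) e) : HasRep K (⨂[K] _ : Fin (k + 1), S) (d * e) :=
  (h.tensor h').comp (tensorPowerSucc K S k)

/-- Matrices over `T` tensored with `Y` are matrices over `T ⊗[K] Y`, so `HasRep.of_matrix` strips
the matrix factor. -/
theorem HasRep.of_matrix_tensor {r d : ℕ} [NeZero r] {X T : Type*} [Ring T] [Algebra K T]
    [Ring X] [Algebra K X]
    (e : X ≃ₐ[K] Matrix (Fin r) (Fin r) T) (h : HasRep K (X ⊗[K] Y) d) :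
    ∃ w, d = r * w ∧ HasRep K (T ⊗[K] Y) w := by
  refine HasRep.of_matrix (h.comp ?_)
  refine (Algebra.TensorProduct.map (e.symm.toAlgHom.comp
    (matrixEquivTensor (Fin r) K T).symm.toAlgHom) (AlgHom.id K Y)).comp ?_
  exact (tensorRightComm K T Y (Matrix (Fin r) (Fin r) K)).comp (matrixEquivTensor (Fin r) K (T ⊗[K] Y)).toAlgHom

end Lift

/-! ### Embeddings from representations, and the arithmetic of degrees -/

section Embed

variable {K T D : Type*} [Field K] [Ring T] [Algebra K T] [DivisionRing D] [Algebra K D]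
  [FiniteDimensional K D]

/-- The space is a one-dimensional right `D`-space, spanned by any nonzero `v`. The `D`-linear
action of `T` on it is by left multiplications by elements of `D`. -/
theorem exists_algHom_of_hasRep (h : HasRep K (T ⊗[K] Dᵐᵒᵖ) (Module.finrank K D)) :
    Nonempty (T →ₐ[K] D) := by
  obtain ⟨ρ⟩ := h.exists_end
  have hpos : 0 < Module.finrank K D := Module.finrank_pos
  let v : Fin (Module.finrank K D) → K := fun _ => 1
  have hv : v ≠ 0 := fun h0 => one_ne_zero (α := K) (congrFun h0 ⟨0, hpos⟩)
  let R (x : D) : Module.End K (Fin (Module.finrank K D) → K) := ρ (1 ⊗ₜ MulOpposite.op x)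
  let Q (t : T) : Module.End K (Fin (Module.finrank K D) → K) := ρ (t ⊗ₜ 1)
  have hRR : ∀ x y u, R y (R x u) = R (x * y) u := by
    intro x y u
    simp [R, ← Module.End.mul_apply, ← map_mul]
  have hRQ : ∀ x t u, Q t (R x u) = R x (Q t u) := by
    intro x y u
    simp [R, Q, ← Module.End.mul_apply, ← map_mul]
  have hQQ : ∀ s t u, Q s (Q t u) = Q (s * t) u := by
    intro x y u
    simp [Q, ← Module.End.mul_apply, ← map_mul]
  have hR1 : ∀ u, R 1 u = u := by
    intro u
    simp [R, ← Algebra.TensorProduct.one_def]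
  let g : D →ₗ[K] (Fin (Module.finrank K D) → K) :=
    { toFun := fun x => R x v
      map_add' := fun x y => by simp [R, TensorProduct.tmul_add]
      map_smul' := fun c x => by simp [R] }
  have hg : ∀ x, g x = R x v := fun _ => rfl
  have hinj : Function.Injective g := by
    rw [injective_iff_map_eq_zero]
    intro x hx
    by_contra hx0
    have : R x⁻¹ (g x) = v := by rw [hg, hRR, mul_inv_cancel₀ hx0, hR1]
    rw [hx, map_zero] at this
    exact hv this.symm
  let e : D ≃ₗ[K] (Fin (Module.finrank K D) → K) :=
    LinearEquiv.ofInjectiveOfFinrankEq g hinj (by simp)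
  have he : ∀ x, e x = R x v := fun _ => rfl
  let f : T →ₗ[K] D :=
    { toFun := fun t => e.symm (Q t v)
      map_add' := fun s t => by simp [Q, TensorProduct.add_tmul]
      map_smul' := fun c t => by simp [Q, ← TensorProduct.smul_tmul'] }
  have hf : ∀ t, R (f t) v = Q t v := fun t => e.apply_symm_apply _
  refine ⟨AlgHom.ofLinearMap f ?_ ?_⟩
  · apply e.injective
    rw [he, he, hf, hR1]
    simp [Q, ← Algebra.TensorProduct.one_def]
  · intro s t
    apply e.injective
    rw [he, he, hf, ← hQQ, ← hf, hRQ, ← hf, hRR]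

end Embed

/-- By Wedderburn `X` is a matrix algebra over a division algebra `T`; the column space `T ^ r`
attains the dimension `r * dim T`, which divides that of every representation. -/
theorem exists_dvd_of_isSimpleRing {K X : Type*} [Field K] [Ring X] [Algebra K X]
    [FiniteDimensional K X] [IsSimpleRing X] :
    ∃ s, HasRep K X s ∧ ∀ d, HasRep K X d → s ∣ d := by
  have := IsArtinianRing.of_finite K X
  obtain ⟨r, hr, T, _, _, _, ⟨e⟩⟩ := IsSimpleRing.exists_algEquiv_matrix_divisionRing_finite K X
  refine ⟨r * Module.finrank K T, (hasRep_self.matrix r).comp e.toAlgHom, fun d h => ?_⟩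
  obtain ⟨w, rfl, hw⟩ := (h.comp e.symm.toAlgHom).of_matrix
  exact mul_dvd_mul_left _ hw.finrank_dvd

/-- With `m` the prime-to-`p` part of `n`, take `l + 1 = (m ^ c) ^ φ(p ^ c)`, which is `1` modulo `p
^ c` by Euler. In Brauer group terms, the power `l + 1` kills the `q`-primary parts for `q ≠ p` and
the power `l` kills the `p`-primary part. -/
theorem exists_tensor_exponent {n p : ℕ} (hp : p.Prime) (hn : n ≠ 0) (c : ℕ) :
    ∃ l, (∀ q, q.Prime → q ∣ n → q ≠ p → q ^ c ∣ l + 1) ∧ p ^ c ∣ l := by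
  let m := ordCompl[p] n
  have hcop : Nat.Coprime (m ^ c) (p ^ c) := 
    (Nat.coprime_ordCompl hp hn).symm.pow c c
  have hφ : 0 < (p ^ c).totient := Nat.totient_pos.2 (pow_pos hp.pos c)
  have hmpos : 0 < (m ^ c) ^ (p ^ c).totient :=
    pow_pos (pow_pos (Nat.ordCompl_pos p hn) c) _
  refine ⟨(m ^ c) ^ (p ^ c).totient - 1, fun q hq hqn hqp => ?_, ?_⟩
  · rw [Nat.sub_add_cancel hmpos]
    refine dvd_trans (pow_dvd_pow_of_dvd ?_ c) (dvd_pow_self _ hφ.ne')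
    have h1 : q ∣ p ^ n.factorization p * m := by rwa [Nat.ordProj_mul_ordCompl_eq_self]
    rcases (Nat.Prime.dvd_mul hq).1 h1 with h | h
    · exact absurd ((Nat.prime_dvd_prime_iff_eq hq hp).1 (hq.dvd_of_dvd_pow h)) hqp
    · exact h
  · exact (Nat.modEq_iff_dvd' hmpos).1 (Nat.ModEq.pow_totient hcop).symm

/-- The arithmetic behind the splitting off of the `p`-primary part. -/
theorem primary_part_arith {p n t t' e d r w s N : ℕ} (hp : p.Prime) (hpn : p ∣ n)
    (hn : n ≠ 0) (hN : N ≠ 0) (hd : d ≠ 0)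
    (ht : ∀ q, q.Prime → q ∣ t → q = p) (ht' : ¬ p ∣ t') (he : ¬ p ∣ e) 
    (htn : t ∣ n * t') (hrt : r * t = n * N) (hw : d * e * (N * t') = r * w)
    (hds : d ∣ s) (hsw : s ∣ w) (hst : s ∣ t ^ 2 * d) : s = d ∧ 1 < t := by
  have ht0 : t ≠ 0 := by
    rintro rfl
    have := mul_ne_zero hn hN
    omega
  -- So `t` is a power of `p`, and it divides `n` because `t'` is prime to `p`. Write `n = p ^ b *
  -- m`.
  obtain ⟨b, rfl⟩ : ∃ b, t = p ^ b := ⟨_, Nat.eq_prime_pow_of_unique_prime_dvd ht0 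
    fun {q} hq h => ht q hq h⟩
  obtain ⟨m, rfl⟩ : p ^ b ∣ n := ((Nat.Prime.coprime_iff_not_dvd hp).2 ht').pow_left b
    |>.dvd_of_dvd_mul_right htn
  obtain ⟨s', rfl⟩ := hds
  obtain ⟨w', rfl⟩ := (Dvd.intro _ rfl : d ∣ d * s').trans hsw
  have hdpos := Nat.pos_of_ne_zero hd
  have hpb : 0 < p ^ b := pow_pos hp.pos b
  have hr : r = m * N := by
    apply Nat.eq_of_mul_eq_mul_right hpb
    rw [hrt]; ring
  -- After cancellation the left side is prime to `p`, so `p` divides neither `m` nor `w'`.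
  have h1 : e * t' = m * w' := by
    apply Nat.eq_of_mul_eq_mul_left (Nat.pos_of_ne_zero (mul_ne_zero hd hN))
    rw [hr] at hw
    linear_combination hw
  have h2 : ¬ p ∣ m * w' := by
    rw [← h1, Nat.Prime.dvd_mul hp]
    tauto
  have hm : ¬ p ∣ m := fun h => h2 (h.mul_right _)
  have hw' : ¬ p ∣ w' := fun h => h2 (h.mul_left _)
  have hsw' : s' ∣ w' := Nat.dvd_of_mul_dvd_mul_left hdpos hsw
  have hst' : s' ∣ (p ^ b) ^ 2 := by
    rw [mul_comm] at hst
    exact Nat.dvd_of_mul_dvd_mul_right hdpos hst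
  constructor
  -- The quotient `s'` divides both a power of `p` and `w'`, which is prime to `p`.
  · have hcop : Nat.Coprime s' ((p ^ b) ^ 2) := by
      rw [← pow_mul]
      exact (((Nat.Prime.coprime_iff_not_dvd hp).2 fun h => hw' (h.trans hsw')).pow_left _).symm
    rw [Nat.eq_one_of_dvd_coprimes hcop dvd_rfl hst', mul_one]
  -- If `b = 0` then `n = m`, although `p` divides `n` and not `m`.
  · rcases Nat.eq_zero_or_pos b with rfl | hb
    · simp at hpn
      exact absurd hpn hm
    · exact Nat.one_lt_pow hb.ne' hp.one_lt

universe u v w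

/-! ### Embedding the primary component -/

section Core

variable {K : Type u} {S : Type v} [Field K] [Ring S] [Algebra K S] [FiniteDimensional K S]
  [IsSimpleRing S] [Algebra.IsCentral K S]

/-- If a finite-dimensional division algebra `D` and a central simple algebra `S` act, commuting
with each other, on a space of dimension prime to `p` over `D`, where `p` divides the degree of `S`,
then `D` contains a nontrivial central division algebra. -/
theorem exists_central_division_algHom {p : ℕ} (hp : p.Prime) (hpS : p ∣ Module.finrank K S)
    {D : Type w} [DivisionRing D] [Algebra K D] [FiniteDimensional K D] {e : ℕ} (he : ¬ p ∣ e)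
    (hrep : HasRep K (S ⊗[K] Dᵐᵒᵖ) (Module.finrank K D * e)) :
    ∃ (T : Type (max u v)) (_ : DivisionRing T) (_ : Algebra K T), FiniteDimensional K T ∧
      Algebra.IsCentral K T ∧ 1 < Module.finrank K T ∧ Nonempty (T →ₐ[K] D) := by
  obtain ⟨n, hn, φ, hφ⟩ := exists_form K (AlgebraicClosure K) S
  have hn0 : n ≠ 0 := NeZero.ne n
  have hSn : Module.finrank K S = n ^ 2 := by simpa using finrank_of_form hφ
  have hpn : p ∣ n := hp.dvd_of_dvd_pow (hSn ▸ hpS)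
  have hX : ∀ k, Module.finrank K (⨂[K] _ : Fin k, S) = (n ^ k) ^ 2 := by
    intro k
    rw [finrank_tensorPower, hSn, ← pow_mul, ← pow_mul, mul_comm]
  have hsimple : ∀ k, IsSimpleRing (⨂[K] _ : Fin k, S) := fun k =>
    isSimpleRing_of_form (isBaseChange_kronHom hφ k)
  have hcentral : ∀ k, Algebra.IsCentral K (⨂[K] _ : Fin k, S) := fun k =>
    isCentral_of_form (isBaseChange_kronHom hφ k)
  have hdata : ∀ k, ∃ (r t : ℕ) (T : Type (max u v)) (_ : DivisionRing T) (_ : Algebra K T),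
      NeZero r ∧ FiniteDimensional K T ∧ Algebra.IsCentral K T ∧
      Nonempty ((⨂[K] _ : Fin k, S) ≃ₐ[K] Matrix (Fin r) (Fin r) T) ∧
      Module.finrank K T = t ^ 2 ∧ r * t = n ^ k := fun k =>
    exists_matrix_division (hX k)
  choose r t T hT1 hT2 hr hTfin hTc ex hTt hrt using hdata
  -- With `hlow` below, `n ^ k * t k` is the least dimension of a representation of the `k`-th power
  -- and divides all others.
  have hup : ∀ k, HasRep K (⨂[K] _ : Fin k, S) (n ^ k * t k) := by
    intro k
    obtain ⟨f⟩ := ex k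
    have h1 : HasRep K (T k) (Module.finrank K (T k)) := hasRep_self
    have h2 := (h1.matrix (r k)).comp f.toAlgHom
    rwa [hTt, sq, ← mul_assoc, hrt] at h2
  have hlow : ∀ k d, HasRep K (⨂[K] _ : Fin k, S) d → n ^ k * t k ∣ d := by
    intro k d h
    obtain ⟨f⟩ := ex k
    have := hr k
    obtain ⟨w, rfl, hw⟩ := (h.comp f.symm.toAlgHom).of_matrix
    have h2 := hw.finrank_dvd
    rw [hTt] at h2
    rw [← hrt, mul_assoc, ← sq]
    exact mul_dvd_mul_left _ h2
  -- The powers of the symmetric-tensor representation show that `t k` divides a power of a binomial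
  -- coefficient prime to `q`. The margin in `n + 5 ≤ q ^ c` supplies both `5 ≤ q ^ c` and `n < q ^
  -- c`.
  have hpow : ∀ q c k, q.Prime → n + 5 ≤ q ^ c → q ^ c ∣ k → ¬ q ∣ t k := by
    rintro q c _ hq hc ⟨m, rfl⟩ hdvd
    have h1 := (hasRep_tensorPower hφ (k := q ^ c) (by omega) (by omega)).tensorPower_mul m
    have h2 := hlow _ _ h1
    rw [mul_pow, ← pow_mul] at h2
    have h3 := Nat.dvd_of_mul_dvd_mul_left (pow_pos (Nat.pos_of_ne_zero hn0) _) h2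
    exact not_dvd_choose hq (Nat.pos_of_ne_zero hn0) (by omega)
      (hq.dvd_of_dvd_pow (hdvd.trans h3))
  have hc : ∀ q, q.Prime → n + 5 ≤ q ^ (n + 5) := fun q hq =>
    (Nat.lt_pow_self hq.one_lt).le
  -- For this `l`, `T (l + 1)` plays the `p`-primary component of `S`: its degree is a power of `p`,
  -- while `t l` is prime to `p`.
  obtain ⟨l, hl1, hl2⟩ := exists_tensor_exponent hp hn0 (n + 5)
  have := hr (l + 1)
  have := hTfin (l + 1)
  have := hTc (l + 1)
  have hsT : IsSimpleRing (T (l + 1) ⊗[K] Dᵐᵒᵖ) := isSimpleRing_tensor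
  obtain ⟨s, hs, hsmin⟩ := exists_dvd_of_isSimpleRing (K := K) (X := T (l + 1) ⊗[K] Dᵐᵒᵖ)
  obtain ⟨f⟩ := ex (l + 1)
  -- Tensor the given action of `S ⊗[K] Dᵐᵒᵖ` with a minimal representation of the `l`-th power,
  -- then strip the matrix factor of the power `l + 1`.
  obtain ⟨w, hw, hwrep⟩ := (hrep.tensorPower_succ_tensor (hup l)).of_matrix_tensor f
  have hDop : Module.finrank K Dᵐᵒᵖ = Module.finrank K D :=
    (MulOpposite.opLinearEquiv K).finrank_eq.symm
  have hself := hsmin _ hasRep_self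
  rw [Module.finrank_tensorProduct, hTt, hDop] at hself
  have hds : Module.finrank K D ∣ s := by
    have := (hs.comp (Algebra.TensorProduct.includeRight : Dᵐᵒᵖ →ₐ[K] _)).finrank_dvd
    rwa [hDop] at this
  have htn : t (l + 1) ∣ n * t l := by
    have h1 := hlow _ _ ((hasRep_self (K := K) (X := S)).tensorPower_succ (hup l))
    rw [hSn] at h1
    refine Nat.dvd_of_mul_dvd_mul_left (pow_pos (Nat.pos_of_ne_zero hn0) (l + 1)) ?_
    convert h1 using 1
    ring
  have htp : ∀ q, q.Prime → q ∣ t (l + 1) → q = p := by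
    intro q hq hqt
    by_contra hqp
    have hqn : q ∣ n := hq.dvd_of_dvd_pow (hqt.trans (Dvd.intro_left _ (hrt (l + 1))))
    exact hpow q (n + 5) (l + 1) hq (hc q hq) (hl1 q hq hqn hqp) hqt
  obtain ⟨rfl, hlt⟩ := primary_part_arith hp hpn hn0 (pow_ne_zero l hn0)
    (Module.finrank_pos (R := K) (M := D)).ne' htp
    (hpow p (n + 5) l hp (hc p hp) hl2) he htn ((hrt (l + 1)).trans (pow_succ' n l)) hw hds
    (hsmin _ hwrep) hself
  refine ⟨T (l + 1), hT1 _, hT2 _, hTfin _, hTc _, ?_, exists_algHom_of_hasRep hs⟩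
  rw [hTt]
  exact Nat.one_lt_pow two_ne_zero hlt

end Core

/-! ### Maximal commutative subalgebras -/

section MaximalSubfield

/-- A finite-dimensional central division algebra has a commutative subalgebra whose dimension is
the degree of the algebra. -/
theorem exists_commutative_subalgebra {Z D : Type*} [Field Z] [DivisionRing D] [Algebra Z D]
    [FiniteDimensional Z D] [Algebra.IsCentral Z D] :
    ∃ F : Subalgebra Z D, (∀ x ∈ F, ∀ y ∈ F, x * y = y * x) ∧
      Module.finrank Z D = Module.finrank Z F ^ 2 := by
  obtain ⟨F, hF, hmax⟩ := (measure fun F : Subalgebra Z D =>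
    Module.finrank Z D - Module.finrank Z F).wf.has_min
    {F | ∀ x ∈ F, ∀ y ∈ F, x * y = y * x} ⟨⊥, by
      rintro x hx y -
      obtain ⟨a, rfl⟩ := Algebra.mem_bot.1 hx
      exact Algebra.commutes a y⟩
  refine ⟨F, hF, ?_⟩
  -- By maximality of its dimension, `F` contains its centralizer.
  have hcent : ∀ x, (∀ y ∈ F, x * y = y * x) → x ∈ F := by
    intro x hx
    let G := Algebra.adjoin Z (insert x (F : Set D))
    have hG : G ∈ {F : Subalgebra Z D | ∀ x ∈ F, ∀ y ∈ F, x * y = y * x} := by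
      have hcomm : ∀ a ∈ insert x (F : Set D), ∀ b ∈ insert x (F : Set D), a * b = b * a := by
        rintro a (rfl | ha) b (rfl | hb)
        · rfl
        · exact hx b hb
        · exact (hx a ha).symm
        · exact hF a ha b hb
      have := Algebra.isMulCommutative_adjoin Z hcomm
      exact fun a ha b hb => congrArg Subtype.val (mul_comm' (⟨a, ha⟩ : G) ⟨b, hb⟩)
    have hFG : F ≤ G := fun y hy => Algebra.subset_adjoin (Set.mem_insert_of_mem _ hy)
    have h1 := hmax G hG
    have h2 : Module.finrank Z G ≤ Module.finrank Z D := Submodule.finrank_le G.toSubmodule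
    have h3 : Module.finrank Z F ≤ Module.finrank Z G :=
      Submodule.finrank_mono (s := F.toSubmodule) (t := G.toSubmodule) hFG
    have h4 : Module.finrank Z G ≤ Module.finrank Z F := by
      simp only [InvImage, WellFoundedRelation.rel] at h1
      omega
    have : F = G := Subalgebra.eq_of_le_of_finrank_le hFG h4
    rw [this]
    exact Algebra.subset_adjoin (Set.mem_insert _ _)
  have hFdiv : IsSimpleRing F := by
    have hdom : IsDomain F := inferInstance
    let _ : DivisionRing F := DivisionRing.ofIsUnitOrEqZero fun a =>
      or_iff_not_imp_right.2 fun ha => 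
        IsIntegral.isUnit (R := Z) (Algebra.IsIntegral.isIntegral a) ha
    infer_instance
  have hX : IsSimpleRing (D ⊗[Z] Fᵐᵒᵖ) := isSimpleRing_tensor
  let R : Fᵐᵒᵖ →ₐ[Z] Module.End Z D :=
    (Algebra.lsmul Z Z D : Dᵐᵒᵖ →ₐ[Z] Module.End Z D).comp (AlgHom.op F.val)
  have hR : ∀ f y, R f y = y * f.unop := fun _ _ => rfl
  have hcomm : ∀ a b, Commute (Algebra.lmul Z D a) (R b) := fun a b => LinearMap.ext fun y => by
    simp [hR, mul_assoc]
  let ρ : D ⊗[Z] Fᵐᵒᵖ →ₐ[Z] Module.End Z D :=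
    Algebra.TensorProduct.lift (Algebra.lmul Z D) R hcomm
  have hρ : ∀ d f y, ρ (d ⊗ₜ f) y = d * (y * f.unop) := by
    intro d f y
    exact LinearMap.congr_fun (Algebra.TensorProduct.lift_tmul _ _ hcomm d f) y
  let _ : Module (D ⊗[Z] Fᵐᵒᵖ) D := Module.compHom D ρ.toRingHom
  have hs : ∀ (x : D ⊗[Z] Fᵐᵒᵖ) (y : D), x • y = ρ x y := fun _ _ => rfl
  have : IsScalarTower Z (D ⊗[Z] Fᵐᵒᵖ) D := ⟨fun a x y => by simp [hs]⟩
  have : SMulCommClass Z (D ⊗[Z] Fᵐᵒᵖ) D := ⟨fun a x y => by simp [hs]⟩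
  have : SMulCommClass (D ⊗[Z] Fᵐᵒᵖ) Z D := SMulCommClass.symm _ _ _
  -- Left multiplication by `D` alone already makes `D` simple.
  have : IsSimpleModule (D ⊗[Z] Fᵐᵒᵖ) D := by
    rw [isSimpleModule_iff]
    refine { exists_pair_ne := ⟨⊥, ⊤, bot_ne_top⟩, eq_bot_or_eq_top := fun N => ?_ }
    by_cases hN : N = ⊥
    · exact Or.inl hN
    right
    obtain ⟨x, hx, hx0⟩ := (Submodule.ne_bot_iff N).1 hN
    rw [eq_top_iff]
    intro y _
    have := N.smul_mem ((y * x⁻¹) ⊗ₜ 1) hx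
    rwa [hs, hρ, MulOpposite.unop_one, OneMemClass.coe_one, mul_one, mul_assoc,
      inv_mul_cancel₀ hx0, mul_one] at this
  have := IsArtinianRing.of_finite Z (D ⊗[Z] Fᵐᵒᵖ)
  obtain ⟨I, ⟨eI⟩⟩ := IsSemisimpleRing.exists_linearEquiv_ideal_of_isSimpleModule
    (D ⊗[Z] Fᵐᵒᵖ) D
  have : IsSimpleModule (D ⊗[Z] Fᵐᵒᵖ) I := IsSimpleModule.congr eI.symm
  obtain ⟨n, ⟨e'⟩⟩ := ((IsSimpleRing.isIsotypic (D ⊗[Z] Fᵐᵒᵖ) (D ⊗[Z] Fᵐᵒᵖ) I).of_linearEquiv_type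
    eI.symm).linearEquiv_fun
  have hFop : Module.finrank Z Fᵐᵒᵖ = Module.finrank Z F :=
    (MulOpposite.opLinearEquiv Z).finrank_eq.symm
  have hDpos : 0 < Module.finrank Z D := Module.finrank_pos
  -- The regular module of `D ⊗[Z] Fᵐᵒᵖ` is a sum of `n` copies of `D`.
  have hn : Module.finrank Z F = n := by
    have := (e'.restrictScalars Z).finrank_eq
    rw [Module.finrank_tensorProduct, Module.finrank_pi_fintype, hFop] at this
    simp only [Finset.sum_const, Finset.card_univ, Fintype.card_fin, smul_eq_mul] at this
    rw [mul_comm] at this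
    exact Nat.eq_of_mul_eq_mul_right hDpos this
  let E := Module.End (D ⊗[Z] Fᵐᵒᵖ) D
  have hE : ∀ (φ : E) y, φ y = y * φ 1 := by
    intro φ y
    have := φ.map_smul (y ⊗ₜ[Z] (1 : Fᵐᵒᵖ)) 1
    simpa [hs, hρ] using this
  have hEF : ∀ φ : E, φ 1 ∈ F := by
    intro φ
    apply hcent
    intro y hy
    have := φ.map_smul ((1 : D) ⊗ₜ[Z] MulOpposite.op (⟨y, hy⟩ : F)) 1
    simp only [hs, hρ, one_mul, MulOpposite.unop_op] at this
    rw [← this, hE]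
  -- An endomorphism of this module is right multiplication by its value at `1`, which centralizes
  -- `F` and so lies in `F`.
  let eE : E ≃ₗ[Z] F := LinearEquiv.ofBijective
    { toFun := fun φ => ⟨φ 1, hEF φ⟩
      map_add' := fun _ _ => rfl
      map_smul' := fun _ _ => rfl }
    ⟨fun φ ψ h => LinearMap.ext fun y => by
        rw [hE φ, hE ψ]
        exact congrArg (y * ·) (congrArg Subtype.val h),
     fun f => ⟨{ toFun := fun y => y * f
                 map_add' := fun _ _ => add_mul _ _ _
                 map_smul' := fun x y => by
                  simp only [hs, RingHom.id_apply]
                  induction x using TensorProduct.induction_on with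
                  | zero => simp
                  | tmul d g =>
                    rw [hρ, hρ, mul_assoc, mul_assoc, mul_assoc, hF _ g.unop.2 _ f.2]
                  | add a b ha hb => simp [add_mul, ha, hb] },
       Subtype.ext (one_mul _)⟩⟩
  -- The endomorphism ring of the regular module is a ring of `n` by `n` matrices over `F`; with
  -- `dim F = n` this gives `dim D * n = n * n * n`.
  have hend : Module.finrank Z (D ⊗[Z] Fᵐᵒᵖ) = n * n * Module.finrank Z F := by
    let e1 : (D ⊗[Z] Fᵐᵒᵖ) ≃ₗ[Z] (D ⊗[Z] Fᵐᵒᵖ)ᵐᵒᵖ := MulOpposite.opLinearEquiv Z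
    rw [e1.finrank_eq, (AlgEquiv.moduleEndSelf Z (A := D ⊗[Z] Fᵐᵒᵖ)).toLinearEquiv.finrank_eq,
      (e'.conjAlgEquiv Z).toLinearEquiv.finrank_eq,
      (endVecAlgEquivMatrixEnd (Fin n) Z (D ⊗[Z] Fᵐᵒᵖ) D).toLinearEquiv.finrank_eq,
      Module.finrank_matrix, eE.finrank_eq]
    simp
  rw [Module.finrank_tensorProduct, hFop, hn] at hend
  have hn0 : 0 < n := hn ▸ Module.finrank_pos
  rw [hn, sq]
  exact Nat.eq_of_mul_eq_mul_right hn0 hend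

end MaximalSubfield

/-! ### Prime divisors of dimensions and degrees of elements -/

section Degree

theorem finrank_adjoin_singleton {K F : Type*} [Field K] [Field F] [Algebra K F]
    [FiniteDimensional K F] (x : F) :
    Module.finrank K (Algebra.adjoin K {x}) = (minpoly K x).natDegree := by
  have hx : IsIntegral K x := Algebra.IsIntegral.isIntegral x
  rw [← IntermediateField.adjoin_simple_toSubalgebra_of_isAlgebraic hx.isAlgebraic]
  exact IntermediateField.adjoin.finrank hx

/-- A prime divisor of the degree of a field extension divides the degree of some element. -/
theorem exists_dvd_natDegree_minpoly {K F : Type*} [Field K] [Field F] [Algebra K F]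
    [FiniteDimensional K F] {ℓ : ℕ} (hℓ : ℓ.Prime) (h : ℓ ∣ Module.finrank K F) :
    ∃ x : F, ℓ ∣ (minpoly K x).natDegree := by
  rw [← Module.finrank_mul_finrank K (separableClosure K F) F, hℓ.dvd_mul] at h
  rcases h with h | h
  · obtain ⟨a, ha⟩ := Field.exists_primitive_element K (separableClosure K F)
    refine ⟨a, ?_⟩
    have h1 : (minpoly K (a : F)) = minpoly K a :=
      minpoly.algHom_eq (separableClosure K F).val Subtype.val_injective a
    rw [h1, ← IntermediateField.adjoin.finrank (Algebra.IsIntegral.isIntegral a), ha,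
      IntermediateField.finrank_top']
    exact h
  -- In the purely inseparable part `ℓ` must be the characteristic, and the minimal polynomial of an
  -- inseparable element is a polynomial in `X ^ ℓ`.
  · obtain ⟨q, hq⟩ := ExpChar.exists K
    have hq' : ExpChar (separableClosure K F) q := expChar_of_injective_algebraMap
      (algebraMap K (separableClosure K F)).injective q
    obtain ⟨m, hm⟩ := IsPurelyInseparable.finrank_eq_pow (separableClosure K F) F q
    rw [hm] at h
    have hdvd : ℓ ∣ q := hℓ.dvd_of_dvd_pow h
    cases hq with
    | zero => exact absurd (Nat.dvd_one.1 hdvd) hℓ.ne_one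
    | prime hqp =>
      obtain rfl : ℓ = q := (Nat.prime_dvd_prime_iff_eq hℓ hqp).1 hdvd
      obtain ⟨x, hx⟩ : ∃ x : F, x ∉ separableClosure K F := by
        by_contra! hall
        have htop : separableClosure K F = ⊤ := eq_top_iff.2 fun x _ => hall x
        have h1 : Module.finrank (separableClosure K F) F = 1 := by
          rw [htop]
          exact IntermediateField.finrank_top
        rw [← hm, h1] at h
        exact hℓ.ne_one (Nat.dvd_one.1 h)
      refine ⟨x, ?_⟩
      rcases Polynomial.separable_or ℓ
        (minpoly.irreducible (Algebra.IsIntegral.isIntegral (R := K) x)) with hsep | ⟨-, g, -, hg⟩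
      · exact absurd hsep hx
      · rw [← hg, Polynomial.natDegree_expand]
        exact Dvd.intro_left _ rfl

/-- A prime divisor of the dimension of a division algebra divides the degree of some element. -/
theorem exists_dvd_finrank_adjoin {K D : Type*} [Field K] [DivisionRing D] [Algebra K D]
    [FiniteDimensional K D] {ℓ : ℕ} (hℓ : ℓ.Prime) (h : ℓ ∣ Module.finrank K D) :
    ∃ x : D, ℓ ∣ Module.finrank K (Algebra.adjoin K {x}) := by
  -- The centre `Z` of `D` may exceed `K`, so the maximal commutative subalgebra `F` is taken over
  -- `Z`. Then `[D : K] = [Z : K] [F : Z] ^ 2` has the same prime divisors as `[F : K]`.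
  let f : K →+* Subring.center D := (algebraMap K D).codRestrict (Subring.center D) fun a => by
    rw [Subring.mem_center_iff]
    exact fun x => (Algebra.commutes a x).symm
  let _ : Algebra K (Subring.center D) := f.toAlgebra
  have : IsScalarTower K (Subring.center D) D := IsScalarTower.of_algebraMap_eq fun _ => rfl
  have : FiniteDimensional (Subring.center D) D := Module.Finite.right K (Subring.center D) D
  have : Algebra.IsCentral (Subring.center D) D := ⟨fun x hx => by
    rw [Subalgebra.mem_center_iff] at hx
    exact ⟨⟨x, Subring.mem_center_iff.2 hx⟩, rfl⟩⟩
  obtain ⟨F, hF, hdim⟩ := exists_commutative_subalgebra (Z := Subring.center D) (D := D)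
  let G : Subalgebra K D := F.restrictScalars K
  have hG : Module.finrank K G = Module.finrank K (Subring.center D) *
      Module.finrank (Subring.center D) F :=
    (Module.finrank_mul_finrank K (Subring.center D) F).symm
  have hℓG : ℓ ∣ Module.finrank K G := by
    rw [← Module.finrank_mul_finrank K (Subring.center D) D, hdim, hℓ.dvd_mul] at h
    rw [hG]
    rcases h with h | h
    · exact h.mul_right _
    · exact (hℓ.dvd_of_dvd_pow h).mul_left _
  let _ : CommRing G := { (inferInstance : Ring G) with
    mul_comm := fun a b => Subtype.ext (hF a a.2 b b.2) }
  have hfield : IsField G :=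
    { exists_pair_ne := ⟨0, 1, zero_ne_one⟩
      mul_comm := mul_comm
      mul_inv_cancel := fun {a} ha =>
        (IsIntegral.isUnit (R := K) (Algebra.IsIntegral.isIntegral a) ha).exists_right_inv }
  let _ : Field G := hfield.toField
  obtain ⟨x, hx⟩ := exists_dvd_natDegree_minpoly (K := K) (F := G) hℓ hℓG
  refine ⟨x, ?_⟩
  rw [← finrank_adjoin_singleton] at hx
  have hmap : (Algebra.adjoin K {x}).map G.val = Algebra.adjoin K {(x : D)} := by
    rw [AlgHom.map_adjoin_singleton]
    rfl
  rw [← hmap]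
  rwa [← ((Algebra.adjoin K {x}).equivMapOfInjective G.val
    Subtype.val_injective).toLinearEquiv.finrank_eq]

end Degree

/-! ### Division algebras of coprime dimensions -/

section Division

variable {K : Type*} [Field K]

/-- The division ring structure on a ring satisfying `IsDivision`. -/
noncomputable abbrev IsDivision.divisionRing {A : Type*} [Ring A] (h : IsDivision A) :
    DivisionRing A :=
  have := h.1
  DivisionRing.ofIsUnitOrEqZero fun a => or_iff_not_imp_right.2 (h.2 a)

theorem isDivision_of_divisionRing (A : Type*) [DivisionRing A] : IsDivision A :=
  ⟨inferInstance, fun _ ha => IsUnit.mk0 _ ha⟩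

theorem IsDivision.of_equiv {A B : Type*} [Ring A] [Ring B] (h : IsDivision A) (e : A ≃+* B) :
    IsDivision B := by
  have := h.1
  refine ⟨e.injective.nontrivial, fun b hb => ?_⟩
  have : IsUnit (e.symm b) := h.2 _ fun h0 => hb (by simpa using h0)
  simpa using this.map e

/-- A tensor product of division algebras of coprime dimensions is a division algebra. -/
theorem isDivision_tensor {B C : Type*} [DivisionRing B] [Algebra K B] [DivisionRing C]
    [Algebra K C] [FiniteDimensional K B] [FiniteDimensional K C]
    (h : Nat.Coprime (Module.finrank K B) (Module.finrank K C)) : IsDivision (B ⊗[K] C) := by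
  have hnt : Nontrivial (B ⊗[K] C) := inferInstance
  have hinv : ∀ x : B ⊗[K] C, x ≠ 0 → ∃ y, x * y = 1 := by
    intro x hx
    -- The right annihilator of `x` is a right ideal, hence a vector space over `B` and over `C`. By
    -- coprimality its dimension is a multiple of that of the whole algebra; being proper, it is
    -- zero.
    let N := LinearMap.ker (LinearMap.mulLeft K x)
    have hN : ∀ y, y ∈ N ↔ x * y = 0 := fun y => Iff.rfl
    let ρ : (B ⊗[K] C)ᵐᵒᵖ →ₐ[K] Module.End K N :=
      { toFun := fun a => (LinearMap.mulRight K a.unop).restrict fun y hy => by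
          rw [hN] at hy ⊢
          rw [LinearMap.mulRight_apply, ← mul_assoc, hy, zero_mul]
        map_one' := by ext; simp
        map_mul' := fun a b => by ext; simp [mul_assoc]
        map_zero' := by ext; simp
        map_add' := fun a b => by ext; simp [mul_add]
        commutes' := fun c => by
          ext
          simp [Algebra.algebraMap_eq_smul_one] }
    have hB := finrank_dvd_of_end (ρ.comp (AlgHom.op
      (Algebra.TensorProduct.includeLeft : B →ₐ[K] B ⊗[K] C)))
    have hC := finrank_dvd_of_end (ρ.comp (AlgHom.op
      (Algebra.TensorProduct.includeRight : C →ₐ[K] B ⊗[K] C)))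
    rw [← (MulOpposite.opLinearEquiv K).finrank_eq] at hB hC
    have hdvd := h.mul_dvd_of_dvd_of_dvd hB hC
    rw [← Module.finrank_tensorProduct] at hdvd
    have hlt : Module.finrank K N < Module.finrank K (B ⊗[K] C) := by
      apply Submodule.finrank_lt
      intro htop
      apply hx
      rw [← mul_one x, ← hN, htop]
      trivial
    have h0 : N = ⊥ := Submodule.finrank_eq_zero.1 (Nat.eq_zero_of_dvd_of_lt hdvd hlt)
    have hsurj : Function.Surjective (LinearMap.mulLeft K x) :=
      LinearMap.injective_iff_surjective.1 (LinearMap.ker_eq_bot.1 h0)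
    exact hsurj 1
  refine ⟨hnt, fun x hx => ?_⟩
  obtain ⟨y, hy⟩ := hinv x hx
  have hy0 : y ≠ 0 := by
    rintro rfl
    rw [mul_zero] at hy
    exact zero_ne_one hy
  obtain ⟨z, hz⟩ := hinv y hy0
  have hxz : x = z := by rw [← mul_one x, ← hz, ← mul_assoc, hy, one_mul]
  exact ⟨⟨x, y, hy, hxz ▸ hz⟩, rfl⟩

variable {A : Type*} [Ring A] [Algebra K A]

/-- The homomorphism from the tensor product of two commuting subalgebras. -/
noncomputable def mulHom (B C : Subalgebra K A) (h : ∀ b ∈ B, ∀ c ∈ C, Commute b c) :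
    B ⊗[K] C →ₐ[K] A :=
  Algebra.TensorProduct.lift B.val C.val fun b c => h b b.2 c c.2

theorem mulHom_tmul (B C : Subalgebra K A) (h : ∀ b ∈ B, ∀ c ∈ C, Commute b c) (b : B) (c : C) :
    mulHom B C h (b ⊗ₜ c) = b * c :=
  have hc : ∀ (x : B) (y : C), Commute (B.val x) (C.val y) := fun x y => h x x.2 y y.2
  Algebra.TensorProduct.lift_tmul B.val C.val hc b c

theorem range_mulHom (B C : Subalgebra K A) (h : ∀ b ∈ B, ∀ c ∈ C, Commute b c) :
    (mulHom B C h).range = B ⊔ C := by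
  apply le_antisymm
  · rintro _ ⟨z, rfl⟩
    change mulHom B C h z ∈ _
    induction z using TensorProduct.induction_on with
    | zero => rw [map_zero]; exact zero_mem _
    | tmul b c =>
      rw [mulHom_tmul]
      exact mul_mem ((le_sup_left : B ≤ B ⊔ C) b.2) ((le_sup_right : C ≤ B ⊔ C) c.2)
    | add a b ha hb => rw [map_add]; exact add_mem ha hb
  · refine sup_le (fun b hb => ⟨(⟨b, hb⟩ : B) ⊗ₜ 1, ?_⟩) fun c hc => ⟨1 ⊗ₜ (⟨c, hc⟩ : C), ?_⟩
    · change mulHom B C h _ = _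
      rw [mulHom_tmul]; simp
    · change mulHom B C h _ = _
      rw [mulHom_tmul]; simp

/-- The tensor product is a division ring, so its homomorphism to a nonzero ring is injective. -/
theorem mulHom_injective [Nontrivial A] {B C : Subalgebra K A}
    (h : ∀ b ∈ B, ∀ c ∈ C, Commute b c) (hB : IsDivision B) (hC : IsDivision C)
    [FiniteDimensional K B] [FiniteDimensional K C]
    (hcop : Nat.Coprime (Module.finrank K B) (Module.finrank K C)) :
    IsDivision (B ⊗[K] C) ∧ Function.Injective (mulHom B C h) := by
  have hdiv : IsDivision (B ⊗[K] C) := by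
    let _ := hB.divisionRing
    let _ := hC.divisionRing
    exact isDivision_tensor hcop
  refine ⟨hdiv, ?_⟩
  rw [injective_iff_map_eq_zero]
  intro z hz
  by_contra hz0
  have := (hdiv.2 z hz0).map (mulHom B C h)
  rw [hz] at this
  exact not_isUnit_zero this

theorem isDivision_sup [Nontrivial A] {B C : Subalgebra K A}
    (h : ∀ b ∈ B, ∀ c ∈ C, Commute b c) (hB : IsDivision B) (hC : IsDivision C)
    [FiniteDimensional K B] [FiniteDimensional K C]
    (hcop : Nat.Coprime (Module.finrank K B) (Module.finrank K C)) :
    IsDivision ↥(B ⊔ C) ∧ FiniteDimensional K ↥(B ⊔ C) ∧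
      Module.finrank K ↥(B ⊔ C) = Module.finrank K B * Module.finrank K C := by
  obtain ⟨hdiv, hinj⟩ := mulHom_injective h hB hC hcop
  let e : (B ⊗[K] C) ≃ₐ[K] ↥(B ⊔ C) := (AlgEquiv.ofInjective _ hinj).trans
    (Subalgebra.equivOfEq _ _ (range_mulHom B C h))
  refine ⟨hdiv.of_equiv e.toRingEquiv, Module.Finite.equiv e.toLinearEquiv, ?_⟩
  rw [← e.toLinearEquiv.finrank_eq, Module.finrank_tensorProduct]

end Division

/-! ### Finite-dimensional subalgebras and coefficients -/

section Subalgebras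

variable {K A : Type*} [Field K] [Ring A] [Algebra K A]

theorem IsDivision.subalgebra (h : IsDivision A) (B : Subalgebra K A) [FiniteDimensional K B] :
    IsDivision B := by
  let _ := h.divisionRing
  have hdom : IsDomain B := inferInstance
  exact ⟨inferInstance, fun a ha =>
    IsIntegral.isUnit (R := K) (Algebra.IsIntegral.isIntegral a) ha⟩

theorem finiteDimensional_of_le {B C : Subalgebra K A} (h : B ≤ C) [FiniteDimensional K C] :
    FiniteDimensional K B :=
  Submodule.finiteDimensional_of_le (S₁ := B.toSubmodule) (S₂ := C.toSubmodule) h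

theorem exists_finset_adjoin (B : Subalgebra K A) [FiniteDimensional K B] :
    ∃ s : Finset A, Algebra.adjoin K (s : Set A) = B :=
  Subalgebra.fg_of_fg_toSubmodule (Module.Finite.iff_fg.1 ‹FiniteDimensional K B›)

theorem IsLFD.sup (h : IsLFD K A) (B C : Subalgebra K A) [FiniteDimensional K B]
    [FiniteDimensional K C] : FiniteDimensional K ↥(B ⊔ C) := by
  classical
  obtain ⟨s, rfl⟩ := exists_finset_adjoin B
  obtain ⟨t, rfl⟩ := exists_finset_adjoin C
  rw [← Algebra.adjoin_union, ← Finset.coe_union]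
  exact h _

theorem finrank_map_of_injective {A' : Type*} [Ring A'] [Algebra K A'] (f : A →ₐ[K] A')
    (hf : Function.Injective f) (B : Subalgebra K A) :
    Module.finrank K (B.map f) = Module.finrank K B :=
  (B.equivMapOfInjective f hf).toLinearEquiv.finrank_eq.symm

/-- A `K`-basis of `C` stays independent over `B` inside `A`; this is used to compare coefficients.
-/
theorem sum_mul_eq_zero {B C : Subalgebra K A} (h : ∀ b ∈ B, ∀ c ∈ C, Commute b c)
    (hinj : Function.Injective (mulHom B C h)) {κ : Type*} [Fintype κ] (g : Module.Basis κ K C)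
    {b : κ → B} (hb : ∑ j, (b j : A) * (g j : A) = 0) (j : κ) : b j = 0 := by
  classical
  have h0 : ∑ j, b j ⊗ₜ[K] g j = 0 := by
    apply hinj
    rw [map_sum, map_zero, ← hb]
    exact Finset.sum_congr rfl fun j _ => mulHom_tmul B C h _ _
  have h1 := DFunLike.congr_fun (congrArg (TensorProduct.equivFinsuppOfBasisRight g) h0) j
  simpa [Finsupp.single_apply] using h1

theorem exists_sum_mul {B C : Subalgebra K A} (h : ∀ b ∈ B, ∀ c ∈ C, Commute b c)
    {κ : Type*} [Fintype κ] (g : Module.Basis κ K C) {z : A} (hz : z ∈ B ⊔ C) :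
    ∃ b : κ → B, z = ∑ j, (b j : A) * (g j : A) := by
  classical
  rw [← range_mulHom B C h] at hz
  obtain ⟨w, rfl⟩ := hz
  obtain ⟨u, rfl⟩ := (TensorProduct.equivFinsuppOfBasisRight (M := B) g).symm.surjective w
  refine ⟨u, ?_⟩
  rw [TensorProduct.equivFinsuppOfBasisRight_symm_apply, Finsupp.sum_fintype _ _ (by simp)]
  change mulHom B C h _ = _
  rw [map_sum]
  exact Finset.sum_congr rfl fun j _ => mulHom_tmul B C h _ _

end Subalgebras

/-! ### The infinite tensor product -/

section Family

variable {K : Type*} [Field K] {ι : Type*} [DecidableEq ι] {R : ι → Type*} [∀ i, Ring (R i)]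
  [∀ i, Algebra K (R i)]

/-- The copy of the subalgebra `B` of the `i`-th factor in the tensor product. -/
noncomputable abbrev factor (i : ι) (B : Subalgebra K (R i)) : Subalgebra K (⨂[K] i, R i) :=
  B.map (PiTensorProduct.singleAlgHom (R := K) (A := R) i)

/-- The subalgebra of the tensor product generated by subalgebras of the factors in `s`. -/
noncomputable def gen (B : ∀ i, Subalgebra K (R i)) (s : Finset ι) :
    Subalgebra K (⨂[K] i, R i) :=
  s.sup fun i => factor i (B i)

theorem gen_insert (B : ∀ i, Subalgebra K (R i)) (a : ι) (s : Finset ι) :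
    gen B (insert a s) = factor a (B a) ⊔ gen B s :=
  Finset.sup_insert

theorem gen_mono {B C : ∀ i, Subalgebra K (R i)} (h : ∀ i, B i ≤ C i) {s t : Finset ι}
    (hst : s ⊆ t) : gen B s ≤ gen C t :=
  Finset.sup_le fun i hi => (Subalgebra.map_mono (h i)).trans
    (Finset.le_sup (f := fun i => factor i (C i)) (hst hi))

theorem factor_le_gen (B : ∀ i, Subalgebra K (R i)) {i : ι} {s : Finset ι} (hi : i ∈ s) :
    factor i (B i) ≤ gen B s :=
  Finset.le_sup (f := fun i => factor i (B i)) hi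

theorem gen_le_algTensor (B : ∀ i, Subalgebra K (R i)) (s : Finset ι) :
    gen B s ≤ algTensor K R := by
  refine Finset.sup_le fun i _ => le_trans ?_ (le_iSup _ i)
  rintro _ ⟨x, -, rfl⟩
  exact ⟨x, rfl⟩

theorem commute_gen (B : ∀ i, Subalgebra K (R i)) {a : ι} {s : Finset ι} (ha : a ∉ s)
    (C : Subalgebra K (R a)) : ∀ x ∈ factor a C, ∀ y ∈ gen B s, Commute x y := by
  intro x hx y hy
  have hle : gen B s ≤ Subalgebra.centralizer K {x} := by
    refine Finset.sup_le fun i hi => ?_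
    rintro _ ⟨z, -, rfl⟩
    obtain ⟨w, -, rfl⟩ := hx
    refine (Subalgebra.mem_centralizer_iff K).2 ?_
    rintro _ rfl
    have hai : a ≠ i := fun h => ha (h ▸ hi)
    exact (Commute.tprod (Pi.mulSingle_commute (f := R) hai w z)).eq
  exact Subalgebra.mem_centralizer_iff K |>.1 (hle hy) x rfl

/-- The empty tensor product is `K`, and it embeds. -/
theorem nontrivial_piTensor [∀ i, Nontrivial (R i)] : Nontrivial (⨂[K] i, R i) := by
  have : Nontrivial (⨂[K] i : (∅ : Finset ι), R i) :=
    (PiTensorProduct.isEmptyEquiv (R := K) (s := fun i : (∅ : Finset ι) => R i)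
      (∅ : Finset ι)).toEquiv.nontrivial
  exact (finTensor_injective K R ∅).nontrivial

theorem single_injective (hdiv : ∀ i, IsDivision (R i)) (i : ι) :
    Function.Injective (PiTensorProduct.singleAlgHom (R := K) (A := R) i) := by
  have := fun i => (hdiv i).1
  have : Nontrivial (⨂[K] i, R i) := nontrivial_piTensor
  let _ := (hdiv i).divisionRing
  exact (PiTensorProduct.singleAlgHom (R := K) (A := R) i).toRingHom.injective

theorem isDivision_gen (hdiv : ∀ i, IsDivision (R i)) (B : ∀ i, Subalgebra K (R i))
    [∀ i, FiniteDimensional K (B i)]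
    (hcop : ∀ i j, i ≠ j → Nat.Coprime (Module.finrank K (B i)) (Module.finrank K (B j)))
    (s : Finset ι) : IsDivision (gen B s) ∧ FiniteDimensional K (gen B s) ∧
      Module.finrank K (gen B s) = ∏ i ∈ s, Module.finrank K (B i) := by
  have := fun i => (hdiv i).1
  have : Nontrivial (⨂[K] i, R i) := nontrivial_piTensor
  induction s using Finset.induction_on with
  | empty =>
    have e : K ≃ₐ[K] (⊥ : Subalgebra K (⨂[K] i, R i)) := (Algebra.botEquiv K _).symm
    have h0 : gen B ∅ = ⊥ := Finset.sup_empty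
    rw [h0]
    exact ⟨(isDivision_of_divisionRing K).of_equiv e.toRingEquiv,
      Module.Finite.equiv e.toLinearEquiv, by simp⟩
  | insert a s ha ih =>
    obtain ⟨h1, h2, h3⟩ := ih
    let e := (B a).equivMapOfInjective _ (single_injective (K := K) hdiv a)
    have hfin : FiniteDimensional K (factor a (B a)) := Module.Finite.equiv e.toLinearEquiv
    have hdim : Module.finrank K (factor a (B a)) = Module.finrank K (B a) :=
      e.toLinearEquiv.finrank_eq.symm
    rw [gen_insert, Finset.prod_insert ha, ← h3, ← hdim]
    refine isDivision_sup (commute_gen B ha _)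
      (((hdiv a).subalgebra (B a)).of_equiv e.toRingEquiv) h1 ?_
    rw [h3, hdim]
    exact Nat.Coprime.prod_right fun i hi => hcop _ _ fun h => ha (h ▸ hi)

theorem exists_mem_gen (hlfd : ∀ i, IsLFD K (R i)) {x : ⨂[K] i, R i} (hx : x ∈ algTensor K R) :
    ∃ (s : Finset ι) (B : ∀ i, Subalgebra K (R i)), (∀ i, FiniteDimensional K (B i)) ∧
      x ∈ gen B s := by
  have hsup : ∀ (s t : Finset ι) (B C : ∀ i, Subalgebra K (R i)),
      gen B s ≤ gen (fun i => B i ⊔ C i) (s ∪ t) ∧ gen C t ≤ gen (fun i => B i ⊔ C i) (s ∪ t) :=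
    fun s t B C => ⟨gen_mono (fun _ => le_sup_left) Finset.subset_union_left,
      gen_mono (fun _ => le_sup_right) Finset.subset_union_right⟩
  -- The subalgebras `gen B s` are directed, since joins of finite-dimensional subalgebras in an
  -- LFD-algebra are finite-dimensional; their union is therefore a subalgebra.
  let U : Subalgebra K (⨂[K] i, R i) :=
    { carrier := {x | ∃ (s : Finset ι) (B : ∀ i, Subalgebra K (R i)),
        (∀ i, FiniteDimensional K (B i)) ∧ x ∈ gen B s}
      mul_mem' := by
        rintro x y ⟨s, B, hB, hx⟩ ⟨t, C, hC, hy⟩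
        exact ⟨s ∪ t, fun i => B i ⊔ C i, fun i => (hlfd i).sup _ _,
          mul_mem ((hsup s t B C).1 hx) ((hsup s t B C).2 hy)⟩
      add_mem' := by
        rintro x y ⟨s, B, hB, hx⟩ ⟨t, C, hC, hy⟩
        exact ⟨s ∪ t, fun i => B i ⊔ C i, fun i => (hlfd i).sup _ _,
          add_mem ((hsup s t B C).1 hx) ((hsup s t B C).2 hy)⟩
      algebraMap_mem' := fun r => ⟨∅, fun i => ⊥, fun i => inferInstance,
        Subalgebra.algebraMap_mem _ r⟩ }
  have hU : algTensor K R ≤ U := by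
    refine iSup_le fun i => ?_
    rintro _ ⟨r, rfl⟩
    refine ⟨{i}, Function.update (fun _ => ⊥) i (Algebra.adjoin K {r}), fun j => ?_, ?_⟩
    · by_cases hj : j = i
      · subst hj
        rw [Function.update_self]
        rw [← Finset.coe_singleton]
        exact hlfd j {r}
      · rw [Function.update_of_ne hj]
        infer_instance
    · apply factor_le_gen _ (Finset.mem_singleton_self i)
      rw [Function.update_self]
      exact ⟨r, Algebra.subset_adjoin rfl, rfl⟩
  exact hU hx

theorem exists_subset_gen (hlfd : ∀ i, IsLFD K (R i))
    (t : Finset (⨂[K] i, R i)) (ht : ∀ x ∈ t, x ∈ algTensor K R) :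
    ∃ (s : Finset ι) (B : ∀ i, Subalgebra K (R i)), (∀ i, FiniteDimensional K (B i)) ∧
      ∀ x ∈ t, x ∈ gen B s := by
  classical
  induction t using Finset.induction_on with
  | empty => exact ⟨∅, fun _ => ⊥, fun _ => inferInstance, by simp⟩
  | insert a t _ ih =>
    obtain ⟨s, B, hB, h⟩ := ih fun x hx => ht x (Finset.mem_insert_of_mem hx)
    obtain ⟨s', C, hC, h'⟩ := exists_mem_gen hlfd (ht a (Finset.mem_insert_self a t))
    refine ⟨s ∪ s', fun i => B i ⊔ C i, fun i => (hlfd i).sup _ _, fun x hx => ?_⟩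
    rcases Finset.mem_insert.1 hx with rfl | hx
    · exact gen_mono (fun _ => le_sup_right) Finset.subset_union_right h'
    · exact gen_mono (fun _ => le_sup_left) Finset.subset_union_left (h x hx)

theorem isDivision_algTensor (hlfd : ∀ i, IsLFD K (R i))
    (hdiv : ∀ i, IsDivision (R i))
    (hcop : ∀ i j, i ≠ j → ∀ (B : Subalgebra K (R i)) (C : Subalgebra K (R j))
      [FiniteDimensional K B] [FiniteDimensional K C],
      Nat.Coprime (Module.finrank K B) (Module.finrank K C)) : IsDivision (algTensor K R) := by
  have := fun i => (hdiv i).1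
  have : Nontrivial (⨂[K] i, R i) := nontrivial_piTensor
  refine ⟨inferInstance, fun x hx => ?_⟩
  obtain ⟨s, B, hB, hxB⟩ := exists_mem_gen hlfd x.2
  obtain ⟨h1, -, -⟩ := isDivision_gen hdiv B (fun i j hij => hcop i j hij _ _) s
  have hu := h1.2 ⟨x, hxB⟩ fun h => hx (Subtype.ext (by simpa using congrArg Subtype.val h))
  exact hu.map (Subalgebra.inclusion (gen_le_algTensor B s))

theorem isLFD_algTensor (hlfd : ∀ i, IsLFD K (R i))
    (hdiv : ∀ i, IsDivision (R i))
    (hcop : ∀ i j, i ≠ j → ∀ (B : Subalgebra K (R i)) (C : Subalgebra K (R j))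
      [FiniteDimensional K B] [FiniteDimensional K C],
      Nat.Coprime (Module.finrank K B) (Module.finrank K C)) : IsLFD K (algTensor K R) := by
  classical
  intro t
  obtain ⟨s, B, hB, h⟩ := exists_subset_gen hlfd (t.image Subtype.val) (by
    intro x hx
    obtain ⟨y, -, rfl⟩ := Finset.mem_image.1 hx
    exact y.2)
  obtain ⟨-, h2, -⟩ := isDivision_gen hdiv B (fun i j hij => hcop i j hij _ _) s
  have hle : (Algebra.adjoin K (t : Set (algTensor K R))).map (algTensor K R).val ≤ gen B s := by
    rw [AlgHom.map_adjoin, Algebra.adjoin_le_iff]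
    rintro _ ⟨x, hx, rfl⟩
    exact h _ (Finset.mem_image_of_mem _ hx)
  have := finiteDimensional_of_le hle
  exact Module.Finite.equiv ((Algebra.adjoin K (t : Set (algTensor K R))).equivMapOfInjective
    (algTensor K R).val Subtype.val_injective).toLinearEquiv.symm

theorem isCentral_algTensor (hlfd : ∀ i, IsLFD K (R i))
    (hdiv : ∀ i, IsDivision (R i))
    (hcop : ∀ i j, i ≠ j → ∀ (B : Subalgebra K (R i)) (C : Subalgebra K (R j))
      [FiniteDimensional K B] [FiniteDimensional K C],
      Nat.Coprime (Module.finrank K B) (Module.finrank K C))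
    (hc : ∀ i, Algebra.IsCentral K (R i)) :
    Algebra.IsCentral K (algTensor K R) := by
  have := fun i => (hdiv i).1
  have : Nontrivial (⨂[K] i, R i) := nontrivial_piTensor
  -- Induction removes one factor at a time: the coefficients of `z` in the factor `a`, over a basis
  -- of the product of the others, are shown to be scalars.
  have key : ∀ (s : Finset ι) (B : ∀ i, Subalgebra K (R i)), (∀ i, FiniteDimensional K (B i)) →
      ∀ z ∈ gen B s, (∀ i r, Commute (PiTensorProduct.singleAlgHom (R := K) (A := R) i r) z) →
        z ∈ (⊥ : Subalgebra K (⨂[K] i, R i)) := by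
    intro s B hB z hz hcomm
    induction s using Finset.induction_on with
    | empty => exact hz
    | insert a s ha ih =>
      apply ih
      obtain ⟨h1, h2, h3⟩ := isDivision_gen hdiv B (fun i j hij => hcop i j hij _ _) s
      let g := Module.finBasis K (gen B s)
      rw [gen_insert] at hz
      obtain ⟨b, rfl⟩ := exists_sum_mul (commute_gen B ha (B a)) g hz
      have hb : ∀ j, ∃ c : K, (b j : ⨂[K] i, R i) = algebraMap K _ c := by
        intro j
        obtain ⟨x, hx, hxb⟩ := (b j).2
        have hxc : ∀ r, r * x = x * r := by
          intro r
          -- Enlarging `B a` by `r` puts the commutators of `r` with the coefficients in a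
          -- finite-dimensional subalgebra, over which the basis `g` is still independent.
          let C := B a ⊔ Algebra.adjoin K {r}
          have hr : FiniteDimensional K (Algebra.adjoin K {r}) := by
            rw [← Finset.coe_singleton]
            exact hlfd a {r}
          have hC : FiniteDimensional K C := (hlfd a).sup _ _
          have hrC : r ∈ C := (le_sup_right : _ ≤ C) (Algebra.subset_adjoin rfl)
          let r' : factor a C := ⟨_, ⟨r, hrC, rfl⟩⟩
          let b' : Fin _ → factor a C := fun j =>
            Subalgebra.inclusion (Subalgebra.map_mono (le_sup_left : B a ≤ C)) (b j)
          let e := C.equivMapOfInjective _ (single_injective (K := K) hdiv a)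
          have hfin : FiniteDimensional K (factor a C) := Module.Finite.equiv e.toLinearEquiv
          have hdim : Module.finrank K (factor a C) = Module.finrank K C :=
            e.toLinearEquiv.finrank_eq.symm
          have hinj := (mulHom_injective (commute_gen B ha C)
            (((hdiv a).subalgebra C).of_equiv e.toRingEquiv) h1 (by
              rw [h3, hdim]
              exact Nat.Coprime.prod_right fun i hi =>
                hcop a i (fun h => ha (by rwa [h])) _ _)).2
          have hsum : ∑ j, ((r' * b' j - b' j * r' : factor a C) : ⨂[K] i, R i) *
              (g j : ⨂[K] i, R i) = 0 := by
            have h4 := (hcomm a r).eq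
            rw [Finset.mul_sum, Finset.sum_mul, ← sub_eq_zero, ← Finset.sum_sub_distrib] at h4
            rw [← h4]
            refine Finset.sum_congr rfl fun j _ => ?_
            have h5 : Commute (PiTensorProduct.singleAlgHom (R := K) (A := R) a r)
              (g j : ⨂[K] i, R i) := commute_gen B ha C _ ⟨r, hrC, rfl⟩ _ (g j).2
            rw [mul_assoc, ← h5.eq, ← mul_assoc, ← mul_assoc, ← sub_mul]
            rfl
          have h6 := sum_mul_eq_zero (commute_gen B ha C) hinj g hsum j
          have h7 := congrArg Subtype.val h6
          apply single_injective (K := K) hdiv a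
          rw [map_mul, map_mul]
          change PiTensorProduct.singleAlgHom (R := K) (A := R) a x = (b j : ⨂[K] i, R i) at hxb
          rw [hxb]
          exact sub_eq_zero.1 h7
        obtain ⟨c, rfl⟩ := (Algebra.IsCentral.mem_center_iff K).1
          (Subalgebra.mem_center_iff.2 hxc)
        exact ⟨c, hxb.symm.trans
          (AlgHom.commutes (PiTensorProduct.singleAlgHom (R := K) (A := R) a) c)⟩
      refine Subalgebra.sum_mem _ fun j _ => ?_
      obtain ⟨c, hc⟩ := hb j
      rw [hc]
      exact mul_mem (Subalgebra.algebraMap_mem _ c) (g j).2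
  refine ⟨fun z hz => ?_⟩
  rw [Subalgebra.mem_center_iff] at hz
  obtain ⟨s, B, hB, hzB⟩ := exists_mem_gen hlfd z.2
  obtain ⟨c, hc⟩ := Algebra.mem_bot.1 (key s B hB z hzB fun i r => congrArg Subtype.val
    (hz ⟨PiTensorProduct.singleAlgHom i r, le_iSup
      (fun i => (PiTensorProduct.singleAlgHom (R := K) (A := R) i).range) i ⟨r, rfl⟩⟩))
  exact Algebra.mem_bot.2 ⟨c, Subtype.ext hc⟩

end Family

/-- A finite-dimensional division algebra whose elements have degrees powers of `p` has only the
prime divisor `p` in its dimension. -/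
theorem eq_of_prime_dvd_finrank {K A : Type*} [Field K] [Ring A] [Algebra K A] (hA : IsDivision A)
    {p : ℕ} (hp : p.Prime)
    (hpow : ∀ r : A, ∃ n : ℕ, Module.finrank K (Algebra.adjoin K ({r} : Set A)) = p ^ n)
    (B : Subalgebra K A) [FiniteDimensional K B] {ℓ : ℕ} (hℓ : ℓ.Prime)
    (h : ℓ ∣ Module.finrank K B) : ℓ = p := by
  let _ := (hA.subalgebra B).divisionRing
  obtain ⟨x, hx⟩ := exists_dvd_finrank_adjoin (K := K) (D := B) hℓ h
  obtain ⟨n, hn⟩ := hpow x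
  rw [← finrank_map_of_injective B.val Subtype.val_injective, AlgHom.map_adjoin_singleton] at hx
  change ℓ ∣ Module.finrank K (Algebra.adjoin K {(x : A)}) at hx
  rw [hn] at hx
  exact (Nat.prime_dvd_prime_iff_eq hℓ hp).1 (hℓ.dvd_of_dvd_pow hx)

/-! ### Passing between subalgebras, actions and the class `d(K)` -/

section

variable {K G : Type*} [Field K] [Ring G] [Algebra K G] [FiniteDimensional K G]

/-- Here `S` acts on `G` by left and `D` by right multiplication. -/
theorem hasRep_of_algHoms {S D : Type*} [Ring S] [Algebra K S] [Ring D] [Algebra K D]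
    (f : S →ₐ[K] G) (g : D →ₐ[K] G) : HasRep K (S ⊗[K] Dᵐᵒᵖ) (Module.finrank K G) := by
  let f' : S →ₐ[K] Module.End K G := (Algebra.lmul K G).comp f
  let g' : Dᵐᵒᵖ →ₐ[K] Module.End K G :=
    (Algebra.lsmul K K G : Gᵐᵒᵖ →ₐ[K] Module.End K G).comp (AlgHom.op g)
  have hf : ∀ s y, f' s y = f s * y := fun _ _ => rfl
  have hg : ∀ d y, g' d y = y * g d.unop := fun _ _ => rfl
  have hcomm : ∀ a b, Commute (f' a) (g' b) := fun a b => LinearMap.ext fun y => by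
    simp [hf, hg, mul_assoc]
  exact hasRep_of_end (Algebra.TensorProduct.lift f' g' hcomm)

end

theorem exists_noncommuting {K T : Type*} [Field K] [Ring T] [Algebra K T]
    [Algebra.IsCentral K T] [Nontrivial T] (h : 1 < Module.finrank K T) :
    ∃ x y : T, x * y ≠ y * x := by
  by_contra! hall
  have htop : (⊤ : Subalgebra K T) = ⊥ := by
    rw [← Algebra.IsCentral.center_eq_bot K T, eq_comm, eq_top_iff]
    exact fun x _ => Subalgebra.mem_center_iff.2 fun y => hall y x
  have h1 : Module.finrank K (⊤ : Subalgebra K T) = 1 := by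
    rw [htop]; exact Subalgebra.finrank_bot
  rw [(Subalgebra.topEquiv (R := K) (A := T)).toLinearEquiv.finrank_eq] at h1
  omega

theorem memD_range {K T A : Type*} [Field K] [DivisionRing T] [Algebra K T] [Algebra.IsCentral K T]
    [FiniteDimensional K T] [Ring A] [Nontrivial A] [Algebra K A] (f : T →ₐ[K] A) :
    MemD K f.range := by
  let e := AlgEquiv.ofInjective f f.toRingHom.injective
  refine ⟨⟨(isDivision_of_divisionRing T).of_equiv e.toRingEquiv, ⟨fun z hz => ?_⟩⟩,
    Module.Finite.equiv e.toLinearEquiv⟩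
  have hc : e.symm z ∈ Subalgebra.center K T := Subalgebra.mem_center_iff.2 fun y =>
    e.injective (by simpa using Subalgebra.mem_center_iff.1 hz (e y))
  obtain ⟨a, ha⟩ := (Algebra.IsCentral.mem_center_iff K).1 hc
  refine Algebra.mem_bot.2 ⟨a, ?_⟩
  rw [← e.apply_symm_apply z, ha, e.commutes]

end LFDTensor

/-! ### The main theorem -/

theorem proposition8p2 {K : Type*} [Field K] (R : Nat.Primes → Type*)
    [∀ p, Ring (R p)] [∀ p, Algebra K (R p)]
    (hdiv : ∀ p, LFDTensor.IsCentralDivision K (R p))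
    (hlfd : ∀ p, LFDTensor.IsLFD K (R p))
    -- `K[r] = K(r)` in a locally finite-dimensional division algebra
    (hpow : ∀ p, ∀ r : R p, ∃ n : ℕ,
      Module.finrank K (Algebra.adjoin K ({r} : Set (R p))) = (p : ℕ) ^ n)
    (hd : ∀ p, ∀ S : Subalgebra K (R p), (∃ x y : S, x * y ≠ y * x) → ¬ LFDTensor.MemD K S) :
    LFDTensor.IsCentralDivision K (LFDTensor.algTensor K R) ∧
    LFDTensor.IsLFD K (LFDTensor.algTensor K R) ∧
    ∀ S : Subalgebra K (LFDTensor.algTensor K R),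
      (∃ x y : S, x * y ≠ y * x) → ¬ LFDTensor.MemD K S := by
  have hdim : ∀ (p : Nat.Primes) (B : Subalgebra K (R p)) [FiniteDimensional K B] {ℓ : ℕ},
      ℓ.Prime → ℓ ∣ Module.finrank K B → ℓ = p := fun p B _ _ hℓ h =>
    LFDTensor.eq_of_prime_dvd_finrank (hdiv p).1 p.2 (hpow p) B hℓ h
  have hcop : ∀ p q : Nat.Primes, p ≠ q → ∀ (B : Subalgebra K (R p)) (C : Subalgebra K (R q))
      [FiniteDimensional K B] [FiniteDimensional K C],
      Nat.Coprime (Module.finrank K B) (Module.finrank K C) := by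
    intro p q hpq B C _ _
    refine Nat.Coprime.symm (Nat.coprime_of_dvd fun ℓ hℓ hC hB => hpq (Subtype.ext ?_))
    exact (hdim p B hℓ hB).symm.trans (hdim q C hℓ hC)
  have hdiv' : ∀ p, LFDTensor.IsDivision (R p) := fun p => (hdiv p).1
  refine ⟨⟨LFDTensor.isDivision_algTensor hlfd hdiv' hcop,
    LFDTensor.isCentral_algTensor hlfd hdiv' hcop fun p => (hdiv p).2⟩,
    LFDTensor.isLFD_algTensor hlfd hdiv' hcop, ?_⟩
  rintro S ⟨x, y, hxy⟩ ⟨⟨hSdiv, hScentral⟩, hSfin⟩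
  classical
  have := fun p => (hdiv' p).1
  obtain ⟨t, ht⟩ := LFDTensor.exists_finset_adjoin S
  obtain ⟨s, B, hB, h⟩ := LFDTensor.exists_subset_gen hlfd (t.image Subtype.val) (by
    intro x hx
    obtain ⟨y, -, rfl⟩ := Finset.mem_image.1 hx
    exact y.2)
  obtain ⟨hGdiv, hGfin, hGdim⟩ :=
    LFDTensor.isDivision_gen hdiv' B (fun i j hij => hcop i j hij _ _) s
  have hle : S.map (LFDTensor.algTensor K R).val ≤ LFDTensor.gen B s := by
    rw [← ht, AlgHom.map_adjoin, Algebra.adjoin_le_iff]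
    rintro _ ⟨x, hx, rfl⟩
    exact h _ (Finset.mem_image_of_mem _ hx)
  let f : S →ₐ[K] LFDTensor.gen B s := (Subalgebra.inclusion hle).comp
    (S.equivMapOfInjective (LFDTensor.algTensor K R).val Subtype.val_injective).toAlgHom
  let _ := hSdiv.divisionRing
  have hScard : Module.finrank K S ≠ 1 := by
    intro h1
    have hbot := Subalgebra.eq_bot_of_finrank_one h1
    obtain ⟨a, ha⟩ := Algebra.mem_bot.1 (hbot.le x.2)
    refine hxy (Subtype.ext ?_)
    change (x : LFDTensor.algTensor K R) * y = y * x
    rw [← ha]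
    exact Algebra.commutes a _
  obtain ⟨p, hp, hpS⟩ := Nat.exists_prime_and_dvd hScard
  -- `G` is a vector space over the division algebra `S`, so the dimension of `S` divides that of
  -- `G`.
  have hpG : p ∣ ∏ i ∈ s, Module.finrank K (B i) := by
    rw [← hGdim]
    exact hpS.trans ((LFDTensor.hasRep_self (K := K) (X := LFDTensor.gen B s)).comp f).finrank_dvd
  obtain ⟨i, hi, hpi⟩ := (Prime.dvd_finsetProd_iff hp.prime _).1 hpG
  obtain rfl : p = i := hdim i (B i) hp hpi
  have he : ¬ (i : ℕ) ∣ ∏ j ∈ s.erase i, Module.finrank K (B j) := by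
    rw [Prime.dvd_finsetProd_iff hp.prime]
    rintro ⟨j, hj, hij⟩
    exact Finset.ne_of_mem_erase hj (Subtype.ext (hdim j (B j) hp hij)).symm
  let g : B i →ₐ[K] LFDTensor.gen B s := (Subalgebra.inclusion (LFDTensor.factor_le_gen B hi)).comp
    ((B i).equivMapOfInjective _ (LFDTensor.single_injective (K := K) hdiv' i)).toAlgHom
  have hrep := LFDTensor.hasRep_of_algHoms f g
  rw [hGdim, ← Finset.mul_prod_erase _ _ hi] at hrep
  let _ := ((hdiv' i).subalgebra (B i)).divisionRing
  obtain ⟨T, _, _, _, _, hT, ⟨φ⟩⟩ := LFDTensor.exists_central_division_algHom hp hpS he hrep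
  -- The image of the nontrivial central division algebra `T` is a subalgebra of `R i` that the
  -- hypothesis excludes.
  let ψ : T →ₐ[K] R i := (B i).val.comp φ
  obtain ⟨a, b, hab⟩ := LFDTensor.exists_noncommuting (K := K) hT
  refine hd i ψ.range ⟨⟨ψ a, a, rfl⟩, ⟨ψ b, b, rfl⟩, fun h => hab ?_⟩ (LFDTensor.memD_range ψ)
  apply ψ.toRingHom.injective
  have h' := congrArg Subtype.val h
  change ψ a * ψ b = ψ b * ψ a at h'
  change ψ (a * b) = ψ (b * a)
  rw [map_mul, map_mul, h']
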